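/- Let $Q$ be a finite quiver with vertex set $I$ (for instance an orientation of the cycle with $m$ vertices), let $k\in I$, and let $Q_\infty$ be the quiver obtained from $Q$ by adding a vertex $\infty$ and one arrow $\infty\to k$. For $\lambda\in\mathbb C^I$, the deformed preprojective algebra $\Pi^\lambda(Q)$ is the quotient of the path algebra of the double quiver $\overline Q$ by $\sum_{a\in Q}[a,a^*]=\sum_{i\in I}\lambda_ie_i$. Let $(\cdot,\cdot)$ be the symmetrized Ringel form, and for a loop-free vertex $i$ put $s_i(\alpha)=\alpha-(\alpha,\epsilon_i)\epsilon_i$ on $\mathbb Z^I$ and $r_i(\lambda)_j=\lambda_j-(\epsilon_i,\epsilon_j)\lambda_i$ on $\mathbb C^I$ (and likewise for $Q_\infty$). Let $E_i:\Pi^\lambda(Q)\text{-Mod}\to\Pi^{r_i(\lambda)}(Q)\text{-Mod}$ be the Crawley-Boevey–Holland reflection functor (and likewise for $Q_\infty$). For $\eta\in\mathbb Z^I$ and $\alpha=(1,\eta)$, put $\lambda_\alpha=(-\lambda\cdot\eta,\lambda)\in\mathbb C^{I\cup\{\infty\}}$, $\Pi=\Pi^{\lambda_\alpha}(Q_\infty)$,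 $B=e_\infty\Pi e_\infty$, and $$F_{\lambda,\eta}:\Pi\text{-Mod}\to\Pi^\lambda(Q)\text{-Mod},\qquad F_{\lambda,\eta}(M)=\operatorname{Hom}_\Pi\bigl(\Pi/(e_\infty),\,\Pi\otimes_B e_\infty M\bigr),$$ where $\Pi^\lambda(Q)$ acts through the canonical homomorphism $\Pi^\lambda(Q)\to\Pi/(e_\infty)$. For $i\in I$ loop-free one has $r_i(\lambda_\alpha)=(r_i(\lambda))_{s_i(\alpha)}$ and $s_i(\alpha)=(1,\eta')$ for some $\eta'\in\mathbb Z^I$. (1) Let $i\in I$ be loop-free (so $i\ne\infty$) and $\lambda_i\ne0$. Then there is an isomorphism of functors $F_{r_i(\lambda),\eta'}\circ E_i\cong E_i\circ F_{\lambda,\eta}$, for every $\eta\in\mathbb Z^I$. (2) Suppose that $\lambda\cdot\beta\ne0$ for all real roots $\beta$ of $Q$. Let $W_\infty$ be the subgroup of the Weyl group of $Q_\infty$ generated by the $s_i$ with $i\in I$ loop-free, and let $w\in W_\infty$. Then $w$ is a product $s_{i_1}\cdots s_{i_n}$ of these generators. For every such expression put $R_w=E_{i_1}\cdots E_{i_n}$,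 formed for $Q$ and for $Q_\infty$, on isomorphism classes of modules. Let $w(\lambda)=r_{i_1}\cdots r_{i_n}(\lambda)$, and for $\eta\in\mathbb Z^I$ write $w(1,\eta)=(1,\eta_w)$. Then $(w(\lambda))_{(1,\eta_w)}=w(\lambda_{(1,\eta)})$, where $w(\mu)\cdot\beta=\mu\cdot w^{-1}(\beta)$. The map $R_w$ restricts to a bijection from the set of isomorphism classes of indecomposable projective $\Pi^\lambda(Q)$-modules to the corresponding set for $\Pi^{w(\lambda)}(Q)$. Moreover, for all $\eta\in\mathbb Z^I$ and $\alpha=(1,\eta)$, $R_w$ restricts to a bijection from $M_{Q_\infty}(\lambda_\alpha,\alpha)$, the set of isomorphism classes of $\Pi^{\lambda_\alpha}(Q_\infty)$-modules of dimension vector $\alpha$, to $M_{Q_\infty}(w(\lambda_\alpha),w(\alpha))$, and $$F_{w(\lambda),\eta_w}\bigl(R_w(x)\bigr)=R_w\bigl(F_{\lambda,\eta}(x)\bigr)$$ for the isomorphism class $x$ of any $\Pi^{\lambda_\alpha}(Q_\infty)$-module, in particular for every $x\in M_{Q_\infty}(\lambda_\alpha,\alpha)$. That is, the map $\bigsqcup_\alpha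 M_{Q_\infty}(\lambda_\alpha,\alpha)\to\{\text{isomorphism classes of }\Pi^\lambda(Q)\text{-modules}\}$ induced by $F$ is $W_\infty$-equivariant. -/

import Mathlib

open CategoryTheory
open scoped TensorProduct

universe u

noncomputable section

/-! ### Quivers, doubles, the Ringel form and the Weyl group -/

/-- A quiver with vertex set `I` and arrow set `A`; the arrow `a` goes from `tail a` to `head a`. -/
structure FinQuiver (I A : Type) where
  tail : A → I
  head : A → I

namespace FinQuiver

variable {I A : Type}

/-- No arrow starts and ends at `i`. -/
def LoopFree (Q : FinQuiver I A) (i : I) : Prop :=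
  ∀ a, ¬ (Q.tail a = i ∧ Q.head a = i)

/-- Source of an arrow of the double quiver: `Sum.inl a` is the arrow `a`, and `Sum.inr a` is the
reverse arrow `a*`. -/
def src (Q : FinQuiver I A) : A ⊕ A → I := Sum.elim Q.tail Q.head

/-- Target of an arrow of the double quiver. -/
def tgt (Q : FinQuiver I A) : A ⊕ A → I := Sum.elim Q.head Q.tail

/-- The sign of an arrow of the double quiver: `1` on `a` and `-1` on `a*`. -/
def sgn : A ⊕ A → ℂ := Sum.elim (fun _ => 1) (fun _ => -1)

/-- The arrows of the double quiver that end at `i`. -/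
abbrev Into (Q : FinQuiver I A) (i : I) : Type := {d : A ⊕ A // Q.tgt d = i}

variable [Fintype I] [DecidableEq I] [Fintype A] [DecidableEq A]

/-- The Ringel form. -/
def ringelForm (Q : FinQuiver I A) (α β : I → ℤ) : ℤ :=
  ∑ i, α i * β i - ∑ a, α (Q.tail a) * β (Q.head a)

/-- The symmetrized Ringel form. -/
def symForm (Q : FinQuiver I A) (α β : I → ℤ) : ℤ :=
  Q.ringelForm α β + Q.ringelForm β α

/-- The coordinate vector `ε_i`. -/
def coord (i : I) : I → ℤ := Pi.single i 1

/-- The simple reflection `s_i` on dimension vectors. -/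
def refl (Q : FinQuiver I A) (i : I) (α : I → ℤ) : I → ℤ :=
  α - Q.symForm α (coord i) • coord i

/-- The reflection `r_i` on parameters. -/
def reflParam (Q : FinQuiver I A) (i : I) (lam : I → ℂ) : I → ℂ :=
  fun j => lam j - (Q.symForm (coord i) (coord j) : ℂ) * lam i

/-- The pairing `λ · α`. -/
def pairing (lam : I → ℂ) (α : I → ℤ) : ℂ := ∑ i, lam i * (α i : ℂ)

/-! ### Deformed preprojective algebras -/

/-- Generators of the path algebra of the double quiver: trivial paths and arrows. -/
inductive Gen (I A : Type) : Type
  | vertex : I → Gen I A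
  | dart : A ⊕ A → Gen I A

/-- The defining relations of `Π^λ(Q)`. The first five kinds present the path algebra of the double
quiver (with paths composed from right to left, so that an arrow acts on a left module as a map from
its source to its target), and the last one is `∑ [a, a*] = ∑ λ_i e_i`. -/
inductive PreprojRel (Q : FinQuiver I A) (lam : I → ℂ) :
    FreeAlgebra ℂ (Gen I A) → FreeAlgebra ℂ (Gen I A) → Prop
  | idem (i : I) : PreprojRel Q lam
      (FreeAlgebra.ι ℂ (Gen.vertex i) * FreeAlgebra.ι ℂ (Gen.vertex i))
      (FreeAlgebra.ι ℂ (Gen.vertex i))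
  | orth (i j : I) (h : i ≠ j) : PreprojRel Q lam
      (FreeAlgebra.ι ℂ (Gen.vertex i) * FreeAlgebra.ι ℂ (Gen.vertex j)) 0
  | unit : PreprojRel Q lam (∑ i, FreeAlgebra.ι ℂ (Gen.vertex i)) 1
  | target (d : A ⊕ A) : PreprojRel Q lam
      (FreeAlgebra.ι ℂ (Gen.vertex (Q.tgt d)) * FreeAlgebra.ι ℂ (Gen.dart d))
      (FreeAlgebra.ι ℂ (Gen.dart d))
  | source (d : A ⊕ A) : PreprojRel Q lam
      (FreeAlgebra.ι ℂ (Gen.dart d) * FreeAlgebra.ι ℂ (Gen.vertex (Q.src d)))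
      (FreeAlgebra.ι ℂ (Gen.dart d))
  | preproj : PreprojRel Q lam
      (∑ a : A,
        (FreeAlgebra.ι ℂ (Gen.dart (Sum.inl a)) * FreeAlgebra.ι ℂ (Gen.dart (Sum.inr a))
          - FreeAlgebra.ι ℂ (Gen.dart (Sum.inr a)) * FreeAlgebra.ι ℂ (Gen.dart (Sum.inl a))))
      (∑ i, lam i • FreeAlgebra.ι ℂ (Gen.vertex i))

/-- The deformed preprojective algebra `Π^λ(Q)`. -/
def Preproj (Q : FinQuiver I A) (lam : I → ℂ) : Type := RingQuot (PreprojRel Q lam)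

instance (Q : FinQuiver I A) (lam : I → ℂ) : Ring (Q.Preproj lam) :=
  inferInstanceAs (Ring (RingQuot (PreprojRel Q lam)))

instance (Q : FinQuiver I A) (lam : I → ℂ) : Algebra ℂ (Q.Preproj lam) :=
  inferInstanceAs (Algebra ℂ (RingQuot (PreprojRel Q lam)))

namespace Preproj

variable (Q : FinQuiver I A) (lam : I → ℂ)

/-- The quotient map from the free algebra. -/
def mk : FreeAlgebra ℂ (Gen I A) →ₐ[ℂ] Q.Preproj lam := RingQuot.mkAlgHom ℂ (PreprojRel Q lam)

/-- The idempotent `e_i`. -/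
def e (i : I) : Q.Preproj lam := mk Q lam (FreeAlgebra.ι ℂ (Gen.vertex i))

/-- The class of an arrow of the double quiver. -/
def arr (d : A ⊕ A) : Q.Preproj lam := mk Q lam (FreeAlgebra.ι ℂ (Gen.dart d))

theorem mk_rel {x y} (h : PreprojRel Q lam x y) : mk Q lam x = mk Q lam y :=
  RingQuot.mkAlgHom_rel ℂ h

theorem e_mul_self (i : I) : e Q lam i * e Q lam i = e Q lam i := by
  simpa [e] using mk_rel Q lam (.idem i)

theorem e_mul_ne {i j : I} (h : i ≠ j) : e Q lam i * e Q lam j = 0 := by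
  simpa [e] using mk_rel Q lam (.orth i j h)

theorem sum_e : ∑ i, e Q lam i = 1 := by
  simpa [e] using mk_rel Q lam .unit

theorem e_mul_arr (d : A ⊕ A) : e Q lam (Q.tgt d) * arr Q lam d = arr Q lam d := by
  simpa [e, arr] using mk_rel Q lam (.target d)

theorem arr_mul_e (d : A ⊕ A) : arr Q lam d * e Q lam (Q.src d) = arr Q lam d := by
  simpa [e, arr] using mk_rel Q lam (.source d)

theorem preproj : ∑ a : A, (arr Q lam (.inl a) * arr Q lam (.inr a)
    - arr Q lam (.inr a) * arr Q lam (.inl a)) = ∑ i, lam i • e Q lam i := by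
  simpa [e, arr] using mk_rel Q lam .preproj

/-- Maps out of `Π^λ(Q)` are given by images of the generators that satisfy the relations. -/
def lift {R : Type*} [Ring R] [Algebra ℂ R] (v : I → R) (f : A ⊕ A → R)
    (idem : ∀ i, v i * v i = v i) (orth : ∀ i j, i ≠ j → v i * v j = 0) (unit : ∑ i, v i = 1)
    (target : ∀ d, v (Q.tgt d) * f d = f d) (source : ∀ d, f d * v (Q.src d) = f d)
    (preproj : ∑ a : A, (f (.inl a) * f (.inr a) - f (.inr a) * f (.inl a)) = ∑ i, lam i • v i) :
    Q.Preproj lam →ₐ[ℂ] R :=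
  RingQuot.liftAlgHom ℂ ⟨FreeAlgebra.lift ℂ (fun g => match g with
    | Gen.vertex i => v i
    | Gen.dart d => f d), by
      intro x y h
      induction h with
      | idem i => simpa using idem i
      | orth i j h => simpa using orth i j h
      | unit => simpa using unit
      | target d => simpa using target d
      | source d => simpa using source d
      | preproj => simpa using preproj⟩

theorem lift_e {R : Type*} [Ring R] [Algebra ℂ R] (v : I → R) (f : A ⊕ A → R) (h1 h2 h3 h4 h5 h6)
    (i : I) : lift Q lam v f h1 h2 h3 h4 h5 h6 (e Q lam i) = v i := by
  change RingQuot.liftAlgHom ℂ _ (RingQuot.mkAlgHom ℂ _ _) = _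
  rw [RingQuot.liftAlgHom_mkAlgHom_apply, FreeAlgebra.lift_ι_apply]

theorem lift_arr {R : Type*} [Ring R] [Algebra ℂ R] (v : I → R) (f : A ⊕ A → R)
    (h1 h2 h3 h4 h5 h6) (d : A ⊕ A) :
    lift Q lam v f h1 h2 h3 h4 h5 h6 (arr Q lam d) = f d := by
  change RingQuot.liftAlgHom ℂ _ (RingQuot.mkAlgHom ℂ _ _) = _
  rw [RingQuot.liftAlgHom_mkAlgHom_apply, FreeAlgebra.lift_ι_apply]

theorem induction {C : Q.Preproj lam → Prop} (hc : ∀ t : ℂ, C (algebraMap ℂ _ t))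
    (he : ∀ i, C (e Q lam i)) (ha : ∀ d, C (arr Q lam d)) (hm : ∀ x y, C x → C y → C (x * y))
    (hs : ∀ x y, C x → C y → C (x + y)) (x : Q.Preproj lam) : C x := by
  obtain ⟨y, rfl⟩ := RingQuot.mkAlgHom_surjective ℂ (PreprojRel Q lam) x
  change C (mk Q lam y)
  induction y using FreeAlgebra.induction with
  | grade0 t => rw [AlgHom.commutes]; exact hc t
  | grade1 g =>
    cases g with
    | vertex i => exact he i
    | dart d => exact ha d
  | mul a b h1 h2 => rw [map_mul]; exact hm _ _ h1 h2
  | add a b h1 h2 => rw [map_add]; exact hs _ _ h1 h2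

theorem sgn_preproj : ∑ d : A ⊕ A, sgn d • (arr Q lam d * arr Q lam d.swap)
    = ∑ i, lam i • e Q lam i := by
  rw [← preproj, Fintype.sum_sum_type, ← Finset.sum_add_distrib]
  simp [sgn, sub_eq_add_neg]

theorem sgn_into (i : I) : ∑ c : Q.Into i, sgn c.1 • (arr Q lam c.1 * arr Q lam c.1.swap)
    = lam i • e Q lam i := by
  have h := congrArg (e Q lam i * ·) (sgn_preproj Q lam)
  simp only [Finset.mul_sum, mul_smul_comm, ← mul_assoc] at h
  rw [Finset.sum_eq_single i] at h
  · rw [e_mul_self] at h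
    rw [← h]
    have : ∀ d : A ⊕ A, e Q lam i * arr Q lam d = if Q.tgt d = i then arr Q lam d else 0 := by
      intro d
      split_ifs with hd
      · rw [← hd, e_mul_arr]
      · rw [← e_mul_arr, ← mul_assoc, e_mul_ne Q lam (Ne.symm hd), zero_mul]
    simp only [this, ite_mul, zero_mul, smul_ite, smul_zero]
    rw [← Finset.sum_filter]
    exact (Finset.sum_subtype (p := fun d => Q.tgt d = i) _ (by simp)
      (fun d => sgn d • (arr Q lam d * arr Q lam d.swap))).symm
  · intro j _ hj
    rw [e_mul_ne Q lam (Ne.symm hj), smul_zero]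
  · simp

end Preproj

/-! ### Reflection functors -/

section Reflection

variable (Q : FinQuiver I A) (lam : I → ℂ) (i : I)
variable (M : Type*) [AddCommGroup M] [Module (Q.Preproj lam) M] [Module ℂ M]
  [IsScalarTower ℂ (Q.Preproj lam) M]

open Preproj

/-- The underlying space of the reflection of `M` at `i`. The pair `(x, y)` stands for
`x ∈ ⨁_{j ≠ i} M_j` and a vector `y` of the kernel of
`π = ∑ ± c : ⨁_{c ending at i} M_{src c} → M_i`; this kernel is the new space at the vertex `i`. -/
def reflSpace : Submodule ℂ (M × (Q.Into i → M)) where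
  carrier := {p | e Q lam i • p.1 = 0 ∧ (∀ c, e Q lam (Q.src c.1) • p.2 c = p.2 c) ∧
    ∑ c, sgn c.1 • (arr Q lam c.1 • p.2 c) = 0}
  add_mem' := by
    rintro p q ⟨h1, h2, h3⟩ ⟨k1, k2, k3⟩
    refine ⟨?_, ?_, ?_⟩
    · simp [smul_add, h1, k1]
    · intro c; simp [smul_add, h2 c, k2 c]
    · simp [smul_add, Finset.sum_add_distrib, h3, k3]
  zero_mem' := by simp
  smul_mem' := by
    rintro t p ⟨h1, h2, h3⟩
    refine ⟨?_, ?_, ?_⟩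
    · simp only [Prod.smul_fst]; rw [smul_comm, h1, smul_zero]
    · intro c
      simp only [Prod.smul_snd, Pi.smul_apply]
      rw [smul_comm, h2 c]
    · simp only [Prod.smul_snd, Pi.smul_apply]
      have : ∀ c : Q.Into i, sgn c.1 • (arr Q lam c.1 • t • p.2 c)
          = t • (sgn c.1 • (arr Q lam c.1 • p.2 c)) := by
        intro c
        rw [smul_comm (arr Q lam c.1) t, smul_comm (sgn c.1) t]
      simp only [this, ← Finset.smul_sum, h3, smul_zero]

/-- The action of `e_j` on pairs `(x, y)`. -/
def vertexMap (j : I) : (M × (Q.Into i → M)) →ₗ[ℂ] (M × (Q.Into i → M)) :=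
  if j = i then LinearMap.prod 0 (LinearMap.snd ℂ _ _)
  else LinearMap.prod (Algebra.lsmul ℂ ℂ M (e Q lam j) ∘ₗ LinearMap.fst ℂ _ _) 0

/-- The action of an arrow `d` of the double quiver on pairs `(x, y)`. An arrow ending at `i` acts
as the component at `d` of `± (μπ - λ_i)`, where `μ` has components `c*`; an arrow starting at `i`
acts as the projection of the kernel of `π` to a component; the other arrows act as on `M`. -/
def dartMap (d : A ⊕ A) : (M × (Q.Into i → M)) →ₗ[ℂ] (M × (Q.Into i → M)) :=
  if Q.tgt d = i then
    LinearMap.prod 0 (LinearMap.pi fun c =>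
      (Algebra.lsmul ℂ ℂ M (arr Q lam c.1.swap * arr Q lam d
        - if c.1 = d then (sgn d * lam i) • e Q lam (Q.src d) else 0)) ∘ₗ LinearMap.fst ℂ _ _)
  else if h' : Q.src d = i then
    LinearMap.prod (LinearMap.proj (⟨d.swap, by cases d <;> exact h'⟩ : Q.Into i)
      ∘ₗ LinearMap.snd ℂ _ _) 0
  else LinearMap.prod (Algebra.lsmul ℂ ℂ M (arr Q lam d) ∘ₗ LinearMap.fst ℂ _ _) 0

theorem tgt_swap (d : A ⊕ A) : Q.tgt d.swap = Q.src d := by cases d <;> rfl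

theorem src_swap (d : A ⊕ A) : Q.src d.swap = Q.tgt d := by cases d <;> rfl

theorem sgn_swap (d : A ⊕ A) : sgn d.swap = - sgn d := by cases d <;> simp [sgn]

theorem sgn_mul_self (d : A ⊕ A) : sgn d * sgn d = 1 := by cases d <;> simp [sgn]

theorem vertexMap_self (p : M × (Q.Into i → M)) : vertexMap Q lam i M i p = (0, p.2) := by
  simp [vertexMap]

theorem vertexMap_ne {j : I} (h : j ≠ i) (p : M × (Q.Into i → M)) :
    vertexMap Q lam i M j p = (e Q lam j • p.1, 0) := by
  simp [vertexMap, h]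

theorem dartMap_tgt {d : A ⊕ A} (h : Q.tgt d = i) (p : M × (Q.Into i → M)) :
    dartMap Q lam i M d p = (0, fun c => (arr Q lam c.1.swap * arr Q lam d) • p.1
      - if c.1 = d then (sgn d * lam i) • (e Q lam (Q.src d) • p.1) else 0) := by
  rw [dartMap, if_pos h]
  refine Prod.ext rfl (funext fun c => ?_)
  change (arr Q lam c.1.swap * arr Q lam d
    - if c.1 = d then (sgn d * lam i) • e Q lam (Q.src d) else 0) • p.1 =
      (arr Q lam c.1.swap * arr Q lam d) • p.1
        - if c.1 = d then (sgn d * lam i) • (e Q lam (Q.src d) • p.1) else 0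
  rw [sub_smul]
  split_ifs
  · rw [smul_assoc]
  · rw [zero_smul]

theorem dartMap_src {d : A ⊕ A} (h : Q.tgt d ≠ i) (h' : Q.src d = i)
    (p : M × (Q.Into i → M)) :
    dartMap Q lam i M d p = (p.2 ⟨d.swap, (tgt_swap Q d).trans h'⟩, 0) := by
  simp only [dartMap, h, h', if_false, dif_pos]
  rfl

theorem dartMap_ne {d : A ⊕ A} (h : Q.tgt d ≠ i) (h' : Q.src d ≠ i)
    (p : M × (Q.Into i → M)) :
    dartMap Q lam i M d p = (arr Q lam d • p.1, 0) := by
  simp [dartMap, h, h']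

theorem sum_into_arr (p : M) : ∑ c : Q.Into i, sgn c.1 • (arr Q lam c.1 • arr Q lam c.1.swap • p)
    = lam i • (e Q lam i • p) := by
  have h := congrArg (· • p) (sgn_into Q lam i)
  simp only [Finset.sum_smul, smul_assoc, mul_smul] at h
  exact h

theorem vertexMap_mem (j : I) {p : M × (Q.Into i → M)} (hp : p ∈ reflSpace Q lam i M) :
    vertexMap Q lam i M j p ∈ reflSpace Q lam i M := by
  obtain ⟨h1, h2, h3⟩ := hp
  by_cases h : j = i
  · subst h
    rw [vertexMap_self]
    exact ⟨smul_zero _, h2, h3⟩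
  · rw [vertexMap_ne Q lam i M h]
    refine ⟨?_, by simp, by simp⟩
    rw [← mul_smul, e_mul_ne Q lam (Ne.symm h), zero_smul]

theorem dartMap_mem (d : A ⊕ A) {p : M × (Q.Into i → M)} (hp : p ∈ reflSpace Q lam i M) :
    dartMap Q lam i M d p ∈ reflSpace Q lam i M := by
  obtain ⟨h1, h2, h3⟩ := hp
  by_cases h : Q.tgt d = i
  · rw [dartMap_tgt Q lam i M h]
    refine ⟨smul_zero _, ?_, ?_⟩
    · intro c
      have h4 : e Q lam (Q.src c.1) * arr Q lam c.1.swap = arr Q lam c.1.swap := by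
        rw [← tgt_swap, e_mul_arr]
      simp only [smul_sub, ← mul_smul, ← mul_assoc, h4]
      congr 1
      split_ifs with hc
      · rw [hc, smul_comm, ← mul_smul, e_mul_self]
      · simp
    · simp only [smul_sub, Finset.sum_sub_distrib, mul_smul]
      have hd : e Q lam i * arr Q lam d = arr Q lam d := by
        subst h
        exact e_mul_arr Q lam d
      rw [sum_into_arr, ← mul_smul (e Q lam i), hd, Finset.sum_eq_single ⟨d, h⟩]
      · simp only [if_true]
        rw [smul_comm (arr Q lam d) (sgn d), smul_comm (arr Q lam d) (lam _), ← mul_smul,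
          ← mul_smul (arr Q lam d), arr_mul_e, ← mul_smul, mul_assoc, ← mul_assoc, sgn_mul_self,
          one_mul, sub_self]
      · intro c _ hc
        rw [if_neg (fun hh => hc (Subtype.ext hh))]
        simp
      · simp
  · by_cases h' : Q.src d = i
    · rw [dartMap_src Q lam i M h h']
      refine ⟨?_, by simp, by simp⟩
      have := h2 ⟨d.swap, (tgt_swap Q d).trans h'⟩
      rw [← this, ← mul_smul]
      simp only [src_swap]
      rw [e_mul_ne Q lam (Ne.symm h), zero_smul]
    · rw [dartMap_ne Q lam i M h h']
      refine ⟨?_, by simp, by simp⟩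
      rw [← e_mul_arr, ← mul_smul, ← mul_assoc, e_mul_ne Q lam (Ne.symm h), zero_mul, zero_smul]

/-- The action of `e_j` on the reflection of `M` at `i`. -/
def vertexEnd (j : I) : Module.End ℂ (reflSpace Q lam i M) :=
  (vertexMap Q lam i M j).restrict fun _ hp => vertexMap_mem Q lam i M j hp

/-- The action of an arrow of the double quiver on the reflection of `M` at `i`. -/
def dartEnd (d : A ⊕ A) : Module.End ℂ (reflSpace Q lam i M) :=
  (dartMap Q lam i M d).restrict fun _ hp => dartMap_mem Q lam i M d hp

theorem LoopFree.src_ne {Q : FinQuiver I A} {i : I} (h : Q.LoopFree i) {d : A ⊕ A}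
    (hd : Q.tgt d = i) : Q.src d ≠ i := by
  cases d with
  | inl a => exact fun h' => h a ⟨h', hd⟩
  | inr a => exact fun h' => h a ⟨hd, h'⟩

theorem symForm_coord_self {Q : FinQuiver I A} {i : I} (h : Q.LoopFree i) :
    Q.symForm (coord i) (coord i) = 2 := by
  have : ∀ a, (coord i (Q.tail a) * coord i (Q.head a) : ℤ) = 0 := by
    intro a
    by_cases h1 : Q.tail a = i
    · have h2 : Q.head a ≠ i := fun h2 => h a ⟨h1, h2⟩
      simp [coord, Pi.single_apply, h2]
    · simp [coord, Pi.single_apply, h1]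
  simp only [symForm, ringelForm, this]
  simp [coord, Pi.single_apply]

theorem symForm_coord_ne (Q : FinQuiver I A) {i j : I} (h : j ≠ i) :
    (Q.symForm (coord i) (coord j) : ℂ) =
      - ∑ d : A ⊕ A, if Q.src d = i ∧ Q.tgt d = j then 1 else 0 := by
  have h0 : ∀ x : I, (coord i x * coord j x : ℤ) = 0 := by
    intro x
    by_cases hx : x = i
    · subst hx
      simp [coord, h.symm]
    · simp [coord, Pi.single_apply, hx]
  have h1 : ∀ x y : I, (coord i x * coord j y : ℤ) = if x = i ∧ y = j then 1 else 0 := by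
    intro x y
    simp only [coord, Pi.single_apply, ite_and]
    split_ifs <;> simp
  have h2 : ∀ x y : I, (coord j x * coord i y : ℤ) = if y = i ∧ x = j then 1 else 0 := by
    intro x y
    rw [mul_comm, h1]
  have h3 : ∀ x : I, (coord j x * coord i x : ℤ) = 0 := fun x => by rw [mul_comm, h0]
  have h4 : (∑ d : A ⊕ A, if Q.src d = i ∧ Q.tgt d = j then (1 : ℂ) else 0) =
      (∑ a, if Q.tail a = i ∧ Q.head a = j then (1 : ℂ) else 0)
        + ∑ a, if Q.head a = i ∧ Q.tail a = j then (1 : ℂ) else 0 := Fintype.sum_sum_type _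
  rw [h4]
  simp only [symForm, ringelForm, h0, h3, h1, h2, Finset.sum_const_zero]
  push_cast
  ring

theorem dartMap_dartMap_tgt (h : Q.LoopFree i) {d : A ⊕ A} (hd : Q.tgt d = i)
    (p : M × (Q.Into i → M)) :
    dartMap Q lam i M d (dartMap Q lam i M d.swap p) =
      (0, fun c => arr Q lam c.1.swap • arr Q lam d • p.2 ⟨d, hd⟩
        - if c.1 = d then (sgn d * lam i) • (e Q lam (Q.src d) • p.2 ⟨d, hd⟩) else 0) := by
  rw [dartMap_src Q lam i M (d := d.swap) (by rw [tgt_swap]; exact h.src_ne hd)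
    (by rw [src_swap]; exact hd), dartMap_tgt Q lam i M hd]
  simp only [Sum.swap_swap, mul_smul]

theorem dartMap_dartMap_ne {d : A ⊕ A} (hd : Q.tgt d ≠ i)
    (p : M × (Q.Into i → M)) :
    dartMap Q lam i M d (dartMap Q lam i M d.swap p) =
      (arr Q lam d • arr Q lam d.swap • p.1
        + (if Q.src d = i then (sgn d * lam i) • (e Q lam (Q.tgt d) • p.1) else 0), 0) := by
  by_cases hs : Q.src d = i
  · rw [dartMap_tgt Q lam i M (d := d.swap) (by rw [tgt_swap]; exact hs),
      dartMap_src Q lam i M hd hs]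
    simp only [if_true, Sum.swap_swap, mul_smul, src_swap, sgn_swap, hs]
    rw [neg_smul, sub_neg_eq_add]
  · rw [dartMap_ne Q lam i M (d := d.swap) (by rw [tgt_swap]; exact hs)
      (by rw [src_swap]; exact hd), dartMap_ne Q lam i M hd hs]
    simp only [hs, if_false, add_zero]

theorem sum_dartMap (h : Q.LoopFree i) {p : M × (Q.Into i → M)} (hp : p ∈ reflSpace Q lam i M) :
    ∑ d : A ⊕ A, sgn d • dartMap Q lam i M d (dartMap Q lam i M d.swap p)
      = ∑ j, Q.reflParam i lam j • vertexMap Q lam i M j p := by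
  obtain ⟨h1, h2, h3⟩ := hp
  have key : ∀ d : A ⊕ A, sgn d • dartMap Q lam i M d (dartMap Q lam i M d.swap p) =
      (sgn d • (arr Q lam d • arr Q lam d.swap • p.1)
        - (if Q.tgt d = i then sgn d • (arr Q lam d • arr Q lam d.swap • p.1) else 0)
        + ∑ j, (if Q.src d = i ∧ Q.tgt d = j then
            lam i • (if j = i then 0 else e Q lam j • p.1) else 0),
      if hd : Q.tgt d = i then fun c => sgn d • (arr Q lam c.1.swap • arr Q lam d • p.2 ⟨d, hd⟩)
        - if c.1 = d then lam i • p.2 c else 0 else 0) := by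
    intro d
    by_cases hd : Q.tgt d = i
    · have hs : Q.src d ≠ i := h.src_ne hd
      rw [dartMap_dartMap_tgt Q lam i M h hd]
      refine Prod.ext ?_ (funext fun c => ?_)
      · simp [hd, hs]
      · simp only [Prod.smul_snd, Pi.smul_apply, hd, dif_pos, smul_sub]
        congr 1
        split_ifs with hc
        · subst hc
          rw [h2 c, ← mul_smul, ← mul_assoc, sgn_mul_self, one_mul]
        · simp
    · rw [dartMap_dartMap_ne Q lam i M hd]
      refine Prod.ext ?_ ?_
      · simp only [Prod.smul_fst, hd, if_false, sub_zero, smul_add]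
        congr 1
        by_cases hs : Q.src d = i
        · simp only [hs, if_true, true_and]
          rw [Finset.sum_ite_eq, if_pos (Finset.mem_univ _), if_neg hd, ← mul_smul, ← mul_assoc,
            sgn_mul_self, one_mul]
        · simp [hs]
      · simp [hd]
  have e1 : ∑ d : A ⊕ A, sgn d • (arr Q lam d • arr Q lam d.swap • p.1)
      = ∑ j, lam j • (e Q lam j • p.1) := by
    have hh := congrArg (· • p.1) (sgn_preproj Q lam)
    simp only [Finset.sum_smul, smul_assoc, mul_smul] at hh
    exact hh
  have e2 : ∑ d : A ⊕ A,
      (if Q.tgt d = i then sgn d • (arr Q lam d • arr Q lam d.swap • p.1) else 0) = 0 := by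
    rw [← Finset.sum_filter]
    rw [Finset.sum_subtype (p := fun d => Q.tgt d = i) _ (by simp)
      (fun d => sgn d • (arr Q lam d • arr Q lam d.swap • p.1))]
    rw [sum_into_arr, h1, smul_zero]
  simp only [key]
  refine Prod.ext ?_ (funext fun c => ?_)
  · rw [Prod.fst_sum, Prod.fst_sum]
    simp only [Finset.sum_add_distrib, Finset.sum_sub_distrib]
    rw [e1, e2, sub_zero, Finset.sum_comm, ← Finset.sum_add_distrib]
    refine Finset.sum_congr rfl fun j _ => ?_
    by_cases hj : j = i
    · subst hj
      rw [vertexMap_self]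
      simp [h1]
    · rw [vertexMap_ne Q lam i M hj]
      simp only [hj, if_false, Prod.smul_fst, reflParam]
      rw [symForm_coord_ne Q hj, neg_mul, sub_neg_eq_add, add_smul, Finset.sum_mul,
        Finset.sum_smul]
      congr 1
      refine Finset.sum_congr rfl fun d _ => ?_
      split_ifs <;> simp
  · rw [Prod.snd_sum, Prod.snd_sum, Finset.sum_apply, Finset.sum_apply,
      Finset.sum_eq_single (a := i) (s := Finset.univ)]
    · rw [vertexMap_self]
      simp only [Prod.smul_snd, Pi.smul_apply]
      have e3 : ∀ d : A ⊕ A, (if hd : Q.tgt d = i then fun c : Q.Into i =>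
          sgn d • (arr Q lam c.1.swap • arr Q lam d • p.2 ⟨d, hd⟩)
            - if c.1 = d then lam i • p.2 c else 0 else 0) c =
          (if hd : Q.tgt d = i then
            arr Q lam c.1.swap • (sgn d • (arr Q lam d • p.2 ⟨d, hd⟩)) else 0)
          - (if c.1 = d then lam i • p.2 c else 0) := by
        intro d
        by_cases hd : Q.tgt d = i
        · simp only [hd, dif_pos]
          rw [smul_comm (sgn d)]
        · have : c.1 ≠ d := fun hc => hd (hc ▸ c.2)
          simp [hd, this]
      simp only [e3, Finset.sum_sub_distrib]
      have e4 : ∑ d : A ⊕ A, (if hd : Q.tgt d = i then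
            arr Q lam c.1.swap • (sgn d • (arr Q lam d • p.2 ⟨d, hd⟩)) else 0) = 0 := by
        rw [← Finset.sum_subset (Finset.subset_univ (Finset.univ.filter fun d => Q.tgt d = i))]
        · rw [Finset.sum_subtype (p := fun d => Q.tgt d = i) _ (by simp)]
          have : ∀ d : Q.Into i, (if hd : Q.tgt d.1 = i then
              arr Q lam c.1.swap • (sgn d.1 • (arr Q lam d.1 • p.2 ⟨d.1, hd⟩)) else 0)
              = arr Q lam c.1.swap • (sgn d.1 • (arr Q lam d.1 • p.2 d)) :=
            fun d => dif_pos d.2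
          rw [Finset.sum_congr rfl fun d _ => this d, ← Finset.smul_sum, h3, smul_zero]
        · intro d _ hd
          exact dif_neg (by simpa using hd)
      rw [e4, Finset.sum_ite_eq, if_pos (Finset.mem_univ _), zero_sub]
      simp only [reflParam, symForm_coord_self h]
      push_cast
      module
    · intro j _ hj
      rw [vertexMap_ne Q lam i M hj]
      simp
    · simp

/-- The action of `Π^{r_i(λ)}(Q)` on the reflection of a `Π^λ(Q)`-module at `i`. -/
def reflAction (h : Q.LoopFree i) (lam' : I → ℂ) (hlam : lam' = Q.reflParam i lam) :
    Q.Preproj lam' →ₐ[ℂ] Module.End ℂ (reflSpace Q lam i M) :=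
  Preproj.lift Q lam' (vertexEnd Q lam i M) (dartEnd Q lam i M)
    (by
      intro j
      ext p : 2
      simp only [Module.End.mul_apply, vertexEnd, LinearMap.coe_restrict_apply]
      by_cases hj : j = i
      · subst hj; simp [vertexMap_self]
      · simp [vertexMap_ne Q lam i M hj, ← mul_smul, e_mul_self])
    (by
      intro j k hjk
      ext p : 2
      simp only [Module.End.mul_apply, vertexEnd, LinearMap.coe_restrict_apply]
      by_cases hj : j = i
      · subst hj
        rw [vertexMap_ne Q lam j M hjk.symm, vertexMap_self]; simp
      · rw [vertexMap_ne Q lam i M hj]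
        by_cases hk : k = i
        · subst hk
          rw [vertexMap_self]; simp
        · rw [vertexMap_ne Q lam i M hk, ← mul_smul, e_mul_ne Q lam hjk]; simp)
    (by
      ext p : 2
      obtain ⟨h1, _⟩ := p.2
      rw [LinearMap.sum_apply, Submodule.coe_sum]
      simp only [vertexEnd, LinearMap.coe_restrict_apply, Module.End.one_apply]
      have : ∀ j, vertexMap Q lam i M j p.1 = (e Q lam j • p.1.1, if j = i then p.1.2 else 0) := by
        intro j
        by_cases hj : j = i
        · subst hj; rw [vertexMap_self, h1, if_pos rfl]
        · rw [vertexMap_ne Q lam i M hj, if_neg hj]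
      simp only [this]
      refine Prod.ext ?_ ?_
      · rw [Prod.fst_sum, ← Finset.sum_smul, sum_e, one_smul]
      · rw [Prod.snd_sum, Finset.sum_ite_eq', if_pos (Finset.mem_univ _)])
    (by
      intro d
      ext p : 2
      simp only [Module.End.mul_apply, vertexEnd, dartEnd, LinearMap.coe_restrict_apply]
      by_cases hd : Q.tgt d = i
      · rw [dartMap_tgt Q lam i M hd, hd, vertexMap_self]
      · rw [vertexMap_ne Q lam i M hd]
        by_cases hs : Q.src d = i
        · rw [dartMap_src Q lam i M hd hs]
          refine Prod.ext ?_ rfl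
          have := p.2.2.1 ⟨d.swap, (tgt_swap Q d).trans hs⟩
          simpa only [src_swap] using this
        · rw [dartMap_ne Q lam i M hd hs, ← mul_smul, e_mul_arr])
    (by
      intro d
      ext p : 2
      simp only [Module.End.mul_apply, vertexEnd, dartEnd, LinearMap.coe_restrict_apply]
      by_cases hd : Q.tgt d = i
      · rw [vertexMap_ne Q lam i M (h.src_ne hd), dartMap_tgt Q lam i M hd,
          dartMap_tgt Q lam i M hd]
        simp only [← mul_smul, e_mul_self, mul_assoc, arr_mul_e]
      · by_cases hs : Q.src d = i
        · rw [dartMap_src Q lam i M hd hs, dartMap_src Q lam i M hd hs]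
          simp only [hs, vertexMap_self]
        · rw [dartMap_ne Q lam i M hd hs, dartMap_ne Q lam i M hd hs,
            vertexMap_ne Q lam i M hs, ← mul_smul, arr_mul_e])
    (by
      ext p : 2
      have := sum_dartMap Q lam i M h p.2
      subst hlam
      rw [LinearMap.sum_apply, LinearMap.sum_apply, Submodule.coe_sum, Submodule.coe_sum]
      refine Eq.trans ?_ this
      rw [Fintype.sum_sum_type, ← Finset.sum_add_distrib]
      refine Finset.sum_congr rfl fun a _ => ?_
      simp [Module.End.mul_apply, dartEnd, sgn, sub_eq_add_neg])

end Reflection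

open ModuleCat in
/-- The underlying group of the reflection of the module `M` at `i`. -/
def ReflCarrier (Q : FinQuiver I A) (lam : I → ℂ) (i : I) (M : ModuleCat.{u} (Q.Preproj lam)) :
    Type u :=
  reflSpace Q lam i M

open ModuleCat in
instance (Q : FinQuiver I A) (lam : I → ℂ) (i : I) (M : ModuleCat.{u} (Q.Preproj lam)) :
    AddCommGroup (ReflCarrier Q lam i M) :=
  inferInstanceAs (AddCommGroup (reflSpace Q lam i M))

open ModuleCat in
/-- The `Π^{r_i(λ)}(Q)`-module structure on the reflection of `M` at `i`. -/
@[reducible]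
def reflModule (Q : FinQuiver I A) {i : I} (h : Q.LoopFree i) {lam lam' : I → ℂ}
    (hlam : lam' = Q.reflParam i lam) (M : ModuleCat.{u} (Q.Preproj lam)) :
    Module (Q.Preproj lam') (ReflCarrier Q lam i M) :=
  Module.compHom (reflSpace Q lam i M) (reflAction Q lam i M h lam' hlam).toRingHom

open ModuleCat in
theorem reflMap_mem {Q : FinQuiver I A} {lam : I → ℂ} (i : I) {M N : ModuleCat.{u} (Q.Preproj lam)}
    (f : M ⟶ N) (p : M × (Q.Into i → M)) (hp : p ∈ reflSpace Q lam i M) :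
    (f.hom p.1, fun c => f.hom (p.2 c)) ∈ reflSpace Q lam i N := by
  obtain ⟨h1, h2, h3⟩ := hp
  refine ⟨?_, ?_, ?_⟩
  · rw [← map_smul, h1, map_zero]
  · intro c
    rw [← map_smul, h2 c]
  · have h4 : ∀ (t : ℂ) (x : M), t • f.hom x = f.hom (t • x) := by
      intro t x
      rw [← algebraMap_smul (Q.Preproj lam) t (f.hom x), ← algebraMap_smul (Q.Preproj lam) t x,
        map_smul]
    simp only [← map_smul, h4]
    rw [← map_sum, h3, map_zero]

open ModuleCat in
/-- The linear map induced on reflections by a homomorphism of modules. -/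
def reflMap {Q : FinQuiver I A} {lam : I → ℂ} (i : I) {M N : ModuleCat.{u} (Q.Preproj lam)}
    (f : M ⟶ N) : reflSpace Q lam i M →+ reflSpace Q lam i N where
  toFun p := ⟨(f.hom p.1.1, fun c => f.hom (p.1.2 c)), reflMap_mem i f p.1 p.2⟩
  map_zero' := by
    refine Subtype.ext (Prod.ext ?_ (funext fun c => ?_)) <;> exact map_zero f.hom
  map_add' p q := by
    refine Subtype.ext (Prod.ext ?_ (funext fun c => ?_)) <;> exact map_add f.hom _ _

open ModuleCat in
theorem reflMap_smul {Q : FinQuiver I A} {i : I} (h : Q.LoopFree i) {lam lam' : I → ℂ}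
    (hlam : lam' = Q.reflParam i lam) {M N : ModuleCat.{u} (Q.Preproj lam)} (f : M ⟶ N)
    (r : Q.Preproj lam') (p : reflSpace Q lam i M) :
    reflMap i f (reflAction Q lam i M h lam' hlam r p)
      = reflAction Q lam i N h lam' hlam r (reflMap i f p) := by
  have h4 : ∀ (t : ℂ) (x : M), f.hom (t • x) = t • f.hom x := by
    intro t x
    rw [← algebraMap_smul (Q.Preproj lam) t (f.hom x), ← algebraMap_smul (Q.Preproj lam) t x,
      map_smul]
  induction r using Preproj.induction generalizing p with
  | hc t =>
    rw [AlgHom.commutes, AlgHom.commutes, Module.algebraMap_end_apply, Module.algebraMap_end_apply]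
    refine Subtype.ext (Prod.ext ?_ (funext fun c => ?_)) <;> exact h4 _ _
  | he j =>
    rw [reflAction, reflAction, Preproj.lift_e, Preproj.lift_e]
    refine Subtype.ext ?_
    change ((f.hom (vertexMap Q lam i M j p.1).1, fun c => f.hom ((vertexMap Q lam i M j p.1).2 c)) :
      N × (Q.Into i → N)) = vertexMap Q lam i N j (f.hom p.1.1, fun c => f.hom (p.1.2 c))
    by_cases hj : j = i
    · subst hj
      simp [vertexMap_self]
    · rw [vertexMap_ne Q lam i M hj, vertexMap_ne Q lam i N hj]
      refine Prod.ext (map_smul f.hom _ _) (funext fun c => map_zero f.hom)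
  | ha d =>
    rw [reflAction, reflAction, Preproj.lift_arr, Preproj.lift_arr]
    refine Subtype.ext ?_
    change ((f.hom (dartMap Q lam i M d p.1).1, fun c => f.hom ((dartMap Q lam i M d p.1).2 c)) :
      N × (Q.Into i → N)) = dartMap Q lam i N d (f.hom p.1.1, fun c => f.hom (p.1.2 c))
    by_cases hd : Q.tgt d = i
    · rw [dartMap_tgt Q lam i M hd, dartMap_tgt Q lam i N hd]
      refine Prod.ext (map_zero f.hom) (funext fun c => ?_)
      dsimp only
      rw [map_sub, map_smul]
      split_ifs
      · rw [h4, map_smul]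
      · rw [map_zero]
    · by_cases hs : Q.src d = i
      · rw [dartMap_src Q lam i M hd hs, dartMap_src Q lam i N hd hs]
        exact Prod.ext rfl (funext fun c => map_zero f.hom)
      · rw [dartMap_ne Q lam i M hd hs, dartMap_ne Q lam i N hd hs]
        exact Prod.ext (map_smul f.hom _ _) (funext fun c => map_zero f.hom)
  | hm x y hx hy =>
    rw [map_mul, map_mul, Module.End.mul_apply, Module.End.mul_apply, hx, hy]
  | hs x y hx hy =>
    rw [map_add, map_add, LinearMap.add_apply, LinearMap.add_apply, map_add, hx, hy]

open ModuleCat in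
/-- The reflection functor `E_i : Π^λ(Q)-Mod ⥤ Π^{λ'}(Q)-Mod`, `λ' = r_i(λ)`, at a loop-free
vertex `i`. -/
def reflFunctor (Q : FinQuiver I A) {i : I} (h : Q.LoopFree i) {lam lam' : I → ℂ}
    (hlam : lam' = Q.reflParam i lam) :
    ModuleCat.{u} (Q.Preproj lam) ⥤ ModuleCat.{u} (Q.Preproj lam') where
  obj M :=
    letI := reflModule Q h hlam M
    ModuleCat.of (Q.Preproj lam') (ReflCarrier Q lam i M)
  map {M N} f :=
    letI := reflModule Q h hlam M
    letI := reflModule Q h hlam N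
    ModuleCat.ofHom (X := ReflCarrier Q lam i M) (Y := ReflCarrier Q lam i N)
      { toFun := reflMap i f
        map_add' := map_add (reflMap i f)
        map_smul' := reflMap_smul h hlam f }
  map_id _ := rfl
  map_comp _ _ := rfl

/-! ### Corner algebras and the framed quiver -/

section Corner

variable (R : Type) [Ring R] (e : R)

/-- The subgroup `eM` of a module `M`. -/
def cornerPart (M : Type u) [AddCommGroup M] [Module R M] : AddSubgroup M :=
  (DistribSMul.toAddMonoidHom M e).range

/-- The action on `eM` of the element `epe` of the corner ring `B = eRe`. -/
def cornerSMul (M : Type u) [AddCommGroup M] [Module R M] (p : R) (n : cornerPart R e M) :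
    cornerPart R e M :=
  ⟨(e * p * e) • (n : M), (p * e) • (n : M), by
    rw [DistribSMul.toAddMonoidHom_apply, ← mul_smul, mul_assoc]⟩

/-- The submodule of `R ⊗_ℤ eM` generated by `r b ⊗ n - r ⊗ b n` for `b` in `B = eRe`. -/
def balancedRel (M : Type u) [AddCommGroup M] [Module R M] :
    Submodule R (R ⊗[ℤ] cornerPart R e M) :=
  Submodule.span R {x | ∃ (r p : R) (n : cornerPart R e M),
    x = (r * (e * p * e)) ⊗ₜ[ℤ] n - r ⊗ₜ[ℤ] cornerSMul R e M p n}

/-- The map `eM → eN` induced by a homomorphism `M → N`. -/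
def cornerMap {M N : Type u} [AddCommGroup M] [Module R M] [AddCommGroup N] [Module R N]
    (f : M →ₗ[R] N) : cornerPart R e M →ₗ[ℤ] cornerPart R e N :=
  AddMonoidHom.toIntLinearMap
    { toFun := fun n => ⟨f n, by
        obtain ⟨m, hm⟩ := n.2
        exact ⟨f m, by rw [← hm]; exact (map_smul f e m).symm⟩⟩
      map_zero' := Subtype.ext (map_zero f)
      map_add' := fun _ _ => Subtype.ext (map_add f _ _) }

/-- The functor `M ↦ R ⊗_B eM`, where `B = eRe`. -/
def cornerTensor : ModuleCat.{u} R ⥤ ModuleCat.{u} R where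
  obj M := ModuleCat.of R ((R ⊗[ℤ] cornerPart R e M) ⧸ balancedRel R e M)
  map {M N} f := ModuleCat.ofHom (Submodule.mapQ (balancedRel R e M) (balancedRel R e N)
    (TensorProduct.AlgebraTensorModule.map LinearMap.id (cornerMap R e f.hom)) (by
      rw [balancedRel, Submodule.span_le]
      rintro _ ⟨r, p, n, rfl⟩
      refine Submodule.subset_span ⟨r, p, cornerMap R e f.hom n, ?_⟩
      rw [map_sub]
      simp only [TensorProduct.AlgebraTensorModule.map_tmul, LinearMap.id_apply]
      congr 2
      exact Subtype.ext (map_smul f.hom (e * p * e) (n : M))))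
  map_id M := by
    refine ModuleCat.hom_ext (Submodule.linearMap_qext _ (LinearMap.ext fun x => ?_))
    change Submodule.Quotient.mk _ = Submodule.Quotient.mk x
    congr 1
    induction x with
    | zero => rfl
    | tmul r n => rfl
    | add x y hx hy => rw [map_add, hx, hy]
  map_comp f g := by
    refine ModuleCat.hom_ext (Submodule.linearMap_qext _ (LinearMap.ext fun x => ?_))
    change Submodule.Quotient.mk _ = Submodule.Quotient.mk _
    congr 1
    induction x with
    | zero => rfl
    | tmul r n => rfl
    | add x y hx hy => simp only [map_add, hx, hy]

/-- The quotient ring `R/(e)` by the two-sided ideal generated by `e`. -/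
abbrev IdemQuot : Type := (TwoSidedIdeal.span {e}).ringCon.Quotient

/-- The functor `M ↦ Hom_R(R/(e), M)`. -/
def homFromQuot : ModuleCat.{u} R ⥤ ModuleCat.{u} (IdemQuot R e) :=
  ModuleCat.coextendScalars (TwoSidedIdeal.span {e}).ringCon.mk'

end Corner

/-- The quiver `Q_∞`: the vertex `∞ = none` is added to `Q`, with one arrow from `∞` to `k`. -/
def framed (Q : FinQuiver I A) (k : I) : FinQuiver (Option I) (Option A) where
  tail := fun a => a.elim none (fun a => some (Q.tail a))
  head := fun a => a.elim (some k) (fun a => some (Q.head a))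

/-- The dimension vector `(1, η)` of `Q_∞`. -/
def framedDim (η : I → ℤ) : Option I → ℤ := fun j => j.elim 1 η

/-- The parameter `λ_α = (-λ·η, λ)` for `α = (1, η)`. -/
def framedParam (lam : I → ℂ) (η : I → ℤ) : Option I → ℂ := fun j => j.elim (-pairing lam η) lam

/-- The algebra `Π^{λ_α}(Q_∞)`. -/
abbrev FramedPreproj (Q : FinQuiver I A) (k : I) (lam : I → ℂ) (η : I → ℤ) : Type :=
  (Q.framed k).Preproj (framedParam lam η)

/-- The idempotent `e_∞`. -/
abbrev eInf (Q : FinQuiver I A) (k : I) (lam : I → ℂ) (η : I → ℤ) : Q.FramedPreproj k lam η :=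
  Preproj.e (Q.framed k) (framedParam lam η) none

/-- The quotient homomorphism `Π^{λ_α}(Q_∞) → Π^{λ_α}(Q_∞)/(e_∞)`. -/
def quotMap (Q : FinQuiver I A) (k : I) (lam : I → ℂ) (η : I → ℤ) :
    Q.FramedPreproj k lam η →ₐ[ℂ] IdemQuot (Q.FramedPreproj k lam η) (Q.eInf k lam η) where
  __ := (TwoSidedIdeal.span {Q.eInf k lam η}).ringCon.mk'
  commutes' _ := rfl

theorem quotMap_eInf (Q : FinQuiver I A) (k : I) (lam : I → ℂ) (η : I → ℤ) :
    quotMap Q k lam η (Q.eInf k lam η) = 0 := by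
  refine (RingCon.eq _).2 ?_
  have := TwoSidedIdeal.subset_span (R := Q.FramedPreproj k lam η) (Set.mem_singleton (Q.eInf k lam η))
  exact (TwoSidedIdeal.mem_iff _ _).1 this

/-- The canonical homomorphism `Π^λ(Q) → Π^{λ_α}(Q_∞)/(e_∞)`, which sends each vertex and each arrow
of `Q` to the class of the same vertex or arrow of `Q_∞`. -/
def toQuot (Q : FinQuiver I A) (k : I) (lam : I → ℂ) (η : I → ℤ) :
    Q.Preproj lam →ₐ[ℂ] IdemQuot (Q.FramedPreproj k lam η) (Q.eInf k lam η) :=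
  Preproj.lift Q lam
    (fun i => quotMap Q k lam η (Preproj.e (Q.framed k) _ (some i)))
    (fun d => quotMap Q k lam η (Preproj.arr (Q.framed k) _ (d.map some some)))
    (fun i => by rw [← map_mul, Preproj.e_mul_self])
    (fun i j h => by
      rw [← map_mul, Preproj.e_mul_ne _ _ (fun h' => h (Option.some.inj h')), map_zero])
    (by
      have := congrArg (quotMap Q k lam η) (Preproj.sum_e (Q.framed k) (framedParam lam η))
      rw [map_sum, Fintype.sum_option, quotMap_eInf, zero_add, map_one] at this
      exact this)
    (fun d => by
      rw [← map_mul]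
      congr 1
      have := Preproj.e_mul_arr (Q.framed k) (framedParam lam η) (d.map some some)
      cases d <;> exact this)
    (fun d => by
      rw [← map_mul]
      congr 1
      have := Preproj.arr_mul_e (Q.framed k) (framedParam lam η) (d.map some some)
      cases d <;> exact this)
    (by
      have h := congrArg (quotMap Q k lam η) (Preproj.preproj (Q.framed k) (framedParam lam η))
      have h1 : quotMap Q k lam η (Preproj.arr (Q.framed k) _ (.inl none)) = 0 := by
        rw [← Preproj.arr_mul_e, map_mul]
        exact (congrArg _ (quotMap_eInf Q k lam η)).trans (mul_zero _)
      have h2 := quotMap_eInf Q k lam η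
      rw [map_sum, map_sum, Fintype.sum_option, Fintype.sum_option, map_sub, map_mul, map_mul,
        map_smul, h1, h2, zero_mul, mul_zero, sub_zero, smul_zero, zero_add, zero_add] at h
      have h3 : ∀ a : A, quotMap Q k lam η
          (Preproj.arr (Q.framed k) _ (.inl (some a)) * Preproj.arr (Q.framed k) _ (.inr (some a))
            - Preproj.arr (Q.framed k) _ (.inr (some a)) * Preproj.arr (Q.framed k) _ (.inl (some a)))
          = quotMap Q k lam η (Preproj.arr (Q.framed k) _ (.inl (some a)))
              * quotMap Q k lam η (Preproj.arr (Q.framed k) _ (.inr (some a)))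
            - quotMap Q k lam η (Preproj.arr (Q.framed k) _ (.inr (some a)))
              * quotMap Q k lam η (Preproj.arr (Q.framed k) _ (.inl (some a))) :=
        fun a => by rw [map_sub, map_mul, map_mul]
      have h4 : ∀ i : I, quotMap Q k lam η
          (framedParam lam η (some i) • Preproj.e (Q.framed k) _ (some i))
          = lam i • quotMap Q k lam η (Preproj.e (Q.framed k) _ (some i)) :=
        fun i => map_smul _ _ _
      exact ((Finset.sum_congr rfl fun a _ => h3 a).symm.trans h).trans
        (Finset.sum_congr rfl fun i _ => h4 i))

/-- The functor `F(M) = Hom_Π(Π/(e_∞), Π ⊗_B M e_∞)` from `Π`-modules to `Π^λ(Q)`-modules, where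
`Π = Π^{λ_α}(Q_∞)` and `B = e_∞ Π e_∞`. -/
def bceFunctor (Q : FinQuiver I A) (k : I) (lam : I → ℂ) (η : I → ℤ) :
    ModuleCat.{u} (Q.FramedPreproj k lam η) ⥤ ModuleCat.{u} (Q.Preproj lam) :=
  cornerTensor _ (Q.eInf k lam η) ⋙ homFromQuot _ (Q.eInf k lam η) ⋙
    ModuleCat.restrictScalars (Q.toQuot k lam η).toRingHom

/-! ### The reflections `s_i`, `i ≠ ∞`, of the framed quiver -/

theorem symForm_comm (Q : FinQuiver I A) (α β : I → ℤ) : Q.symForm α β = Q.symForm β α :=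
  add_comm _ _

/-- The symmetrized Ringel form as a linear map in its first argument. -/
def symLin (Q : FinQuiver I A) (β : I → ℤ) : (I → ℤ) →ₗ[ℤ] ℤ where
  toFun α := Q.symForm α β
  map_add' x y := by
    simp only [symForm, ringelForm, Pi.add_apply, add_mul, mul_add, Finset.sum_add_distrib]
    ring
  map_smul' c x := by
    simp only [symForm, ringelForm, Pi.smul_apply, smul_eq_mul, mul_assoc, mul_left_comm _ c,
      ← Finset.mul_sum, RingHom.id_apply]
    ring

theorem refl_involutive (Q : FinQuiver I A) {i : I} (h : Q.LoopFree i) :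
    Function.Involutive (Q.refl i) := by
  intro α
  have h1 : Q.symForm (Q.refl i α) (coord i) = - Q.symForm α (coord i) := by
    change Q.symLin (coord i) (α - Q.symForm α (coord i) • coord i) = _
    rw [map_sub, map_smul]
    change Q.symForm α (coord i) - Q.symForm α (coord i) • Q.symForm (coord i) (coord i) = _
    rw [symForm_coord_self h, smul_eq_mul]
    ring
  rw [refl, h1, refl]
  module

/-- The simple reflection `s_i` as an automorphism of the lattice of dimension vectors. -/
def reflEquiv (Q : FinQuiver I A) {i : I} (h : Q.LoopFree i) : (I → ℤ) ≃ₗ[ℤ] (I → ℤ) where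
  toFun := Q.refl i
  invFun := Q.refl i
  left_inv := Q.refl_involutive h
  right_inv := Q.refl_involutive h
  map_add' x y := by
    have := map_add (Q.symLin (coord i)) x y
    change Q.symForm (x + y) (coord i) = Q.symForm x (coord i) + Q.symForm y (coord i) at this
    rw [refl, refl, refl, this]
    module
  map_smul' c x := by
    have := map_smul (Q.symLin (coord i)) c x
    change Q.symForm (c • x) (coord i) = c * Q.symForm x (coord i) at this
    rw [refl, refl, this, RingHom.id_apply]
    module

/-- The Weyl group of `Q`, generated by the reflections at the loop-free vertices. -/
def weylGroup (Q : FinQuiver I A) : Subgroup ((I → ℤ) ≃ₗ[ℤ] (I → ℤ)) :=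
  Subgroup.closure {w | ∃ (i : I) (h : Q.LoopFree i), w = Q.reflEquiv h}

/-- Real roots of `Q`: the Weyl group orbits of the coordinate vectors of loop-free vertices. -/
def IsRealRoot (Q : FinQuiver I A) (β : I → ℤ) : Prop :=
  ∃ w ∈ Q.weylGroup, ∃ i, Q.LoopFree i ∧ β = w (coord i)

/-- `λ · β ≠ 0` for all real roots `β` of `Q`. -/
def IsRegular (Q : FinQuiver I A) (lam : I → ℂ) : Prop :=
  ∀ β, Q.IsRealRoot β → pairing lam β ≠ 0

theorem LoopFree.framed {Q : FinQuiver I A} {i : I} (h : Q.LoopFree i) (k : I) :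
    (Q.framed k).LoopFree (some i) := by
  rintro (_ | a) ⟨h1, h2⟩
  · exact absurd h1 (by simp [FinQuiver.framed])
  · exact h a ⟨Option.some.inj h1, Option.some.inj h2⟩

/-- The restriction to `Q` of `s_i(1, η)`, for a vertex `i` of `Q`; the coordinate of `s_i(1, η)` at
`∞` is `1`. -/
def framedRefl (Q : FinQuiver I A) (k i : I) (η : I → ℤ) : I → ℤ :=
  fun j => (Q.framed k).refl (some i) (framedDim η) (some j)

theorem ringelForm_framed (Q : FinQuiver I A) (k : I) (α β : Option I → ℤ) :
    (Q.framed k).ringelForm α β = α none * β none - α none * β (some k)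
      + Q.ringelForm (fun j => α (some j)) (fun j => β (some j)) := by
  simp only [ringelForm, Fintype.sum_option]
  change _ - (α none * β (some k) + ∑ a : A, α (some (Q.tail a)) * β (some (Q.head a))) = _
  ring

theorem coord_some (i j : I) : coord (some i) (some j) = coord i j := by
  simp [coord, Pi.single_apply]

theorem coord_some_none (i : I) : coord (some i) none = 0 := by simp [coord]

theorem coord_none_some (i : I) : coord (none : Option I) (some i) = 0 := by simp [coord]

theorem symForm_framed_coord (Q : FinQuiver I A) (k i : I) (α : Option I → ℤ) :
    (Q.framed k).symForm α (coord (some i)) = Q.symForm (fun j => α (some j)) (coord i)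
      - α none * coord i k := by
  simp only [symForm, ringelForm_framed, coord_some, coord_some_none]
  ring

theorem pairing_reflParam (Q : FinQuiver I A) (i : I) (lam : I → ℂ) (α : I → ℤ) :
    pairing (Q.reflParam i lam) α = pairing lam α - Q.symForm α (coord i) * lam i := by
  have h : Q.symForm α (coord i) = ∑ j, α j * Q.symForm (coord i) (coord j) := by
    have := LinearMap.pi_apply_eq_sum_univ (Q.symLin (coord i)) α
    refine this.trans (Finset.sum_congr rfl fun j _ => ?_)
    rw [smul_eq_mul, symForm_comm]
    have hx : (fun x => if j = x then (1 : ℤ) else 0) = coord j := by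
      funext x
      simp [coord, Pi.single_apply, eq_comm]
    rw [hx]
    rfl
  rw [h]
  push_cast
  simp only [pairing, reflParam, sub_mul, Finset.sum_sub_distrib, Finset.sum_mul]
  congr 1
  exact Finset.sum_congr rfl fun j _ => by ring

/-- `r_i(λ_α) = (r_i(λ))_{s_i(α)}`. -/
theorem framedParam_refl (Q : FinQuiver I A) (k : I) {i : I} (h : Q.LoopFree i) (lam : I → ℂ)
    (η : I → ℤ) : framedParam (Q.reflParam i lam) (Q.framedRefl k i η) =
      (Q.framed k).reflParam (some i) (framedParam lam η) := by
  funext j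
  cases j with
  | none =>
    have h1 : Q.framedRefl k i η = η - (Q.symForm η (coord i) - coord i k) • coord i := by
      funext j
      simp only [framedRefl, refl, symForm_framed_coord, Pi.sub_apply, Pi.smul_apply, coord_some]
      simp [framedDim]
    have h2 : ∀ (mu : I → ℂ) (c : ℤ), pairing mu (η - c • coord i) = pairing mu η - c * mu i := by
      intro mu c
      simp only [pairing, Pi.sub_apply, Pi.smul_apply, Int.cast_sub, mul_sub,
        Finset.sum_sub_distrib]
      congr 1
      rw [Finset.sum_eq_single i]
      · simp [coord, mul_comm]
      · intro j _ hj
        simp [coord, hj]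
      · simp
    have h3 : (Q.framed k).symForm (coord (some i)) (coord none) = - coord i k := by
      rw [symForm_comm, symForm_framed_coord]
      have : (fun j : I => coord (none : Option I) (some j)) = (0 : I → ℤ) :=
        funext coord_none_some
      rw [this]
      have h0 : Q.symForm 0 (coord i) = 0 := map_zero (Q.symLin (coord i))
      rw [h0]
      simp [coord]
    simp only [framedParam, reflParam, Option.elim_none, Option.elim_some, h3]
    change - pairing (Q.reflParam i lam) _ = _
    rw [h1, h2, pairing_reflParam]
    simp only [reflParam, symForm_coord_self h]
    push_cast
    ring
  | some j =>
    have h1 : (Q.framed k).symForm (coord (some i)) (coord (some j)) =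
        Q.symForm (coord i) (coord j) := by
      rw [symForm_framed_coord, coord_some_none, zero_mul, sub_zero]
      congr 1
      funext x
      exact coord_some i x
    simp only [framedParam, reflParam, Option.elim_some, h1]

/-- The loop-free vertices of `Q`. -/
abbrev LF (Q : FinQuiver I A) : Type := {i : I // Q.LoopFree i}

/-- The action of a word `s_{i_1} ⋯ s_{i_n}` on parameters. -/
def wordParam (Q : FinQuiver I A) : List Q.LF → (I → ℂ) → (I → ℂ)
  | [], lam => lam
  | i :: l, lam => Q.reflParam i.1 (wordParam Q l lam)

/-- The restriction to `Q` of the image of `(1, η)` under a word `s_{i_1} ⋯ s_{i_n}`. -/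
def wordDim (Q : FinQuiver I A) (k : I) : List Q.LF → (I → ℤ) → (I → ℤ)
  | [], η => η
  | i :: l, η => Q.framedRefl k i.1 (wordDim Q k l η)

/-- The composition `E_{i_1} ⋯ E_{i_n}` of reflection functors of `Q`. -/
def wordFunctor (Q : FinQuiver I A) : (l : List Q.LF) → (lam : I → ℂ) →
    ModuleCat.{u} (Q.Preproj lam) ⥤ ModuleCat.{u} (Q.Preproj (Q.wordParam l lam))
  | [], lam => 𝟭 (ModuleCat.{u} (Q.Preproj lam))
  | i :: l, lam => wordFunctor Q l lam ⋙ Q.reflFunctor i.2 rfl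

/-- The reflection functor `E_i`, `i ≠ ∞`, of the quiver `Q_∞`, at the parameter `λ_α`. -/
def framedReflFunctor (Q : FinQuiver I A) (k : I) {i : I} (h : Q.LoopFree i) (lam : I → ℂ)
    (η : I → ℤ) : ModuleCat.{u} (Q.FramedPreproj k lam η) ⥤
      ModuleCat.{u} (Q.FramedPreproj k (Q.reflParam i lam) (Q.framedRefl k i η)) :=
  (Q.framed k).reflFunctor (h.framed k) (Q.framedParam_refl k h lam η)

/-- The composition `E_{i_1} ⋯ E_{i_n}`, all `i_j ≠ ∞`, of reflection functors of `Q_∞`. -/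
def framedWordFunctor (Q : FinQuiver I A) (k : I) : (l : List Q.LF) → (lam : I → ℂ) →
    (η : I → ℤ) → ModuleCat.{u} (Q.FramedPreproj k lam η) ⥤
      ModuleCat.{u} (Q.FramedPreproj k (Q.wordParam l lam) (Q.wordDim k l η))
  | [], lam, η => 𝟭 (ModuleCat.{u} (Q.FramedPreproj k lam η))
  | i :: l, lam, η => framedWordFunctor Q k l lam η ⋙ Q.framedReflFunctor k i.2 _ _

/-- The element `s_{i_1} ⋯ s_{i_n}` of the Weyl group of `Q_∞`. -/
def wordElt (Q : FinQuiver I A) (k : I) (l : List Q.LF) :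
    (Option I → ℤ) ≃ₗ[ℤ] (Option I → ℤ) :=
  (l.map fun i => (Q.framed k).reflEquiv (i.2.framed k)).prod

/-- The group `W_∞`: the subgroup of the Weyl group of `Q_∞` generated by the `s_i`, `i ≠ ∞`. -/
def wInf (Q : FinQuiver I A) (k : I) : Subgroup ((Option I → ℤ) ≃ₗ[ℤ] (Option I → ℤ)) :=
  Subgroup.closure {w | ∃ i : Q.LF, w = (Q.framed k).reflEquiv (i.2.framed k)}

/-! ### Isomorphism classes -/

/-- Isomorphism classes of `R`-modules. -/
abbrev IsoClass (R : Type) [Ring R] : Type (u + 1) :=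
  Quotient (isIsomorphicSetoid (ModuleCat.{u} R))

/-- The isomorphism class of a module. -/
def isoClass {R : Type} [Ring R] (M : ModuleCat.{u} R) : IsoClass.{u} R :=
  Quotient.mk (isIsomorphicSetoid _) M

/-- The map on isomorphism classes induced by a functor. -/
def onClasses {R S : Type} [Ring R] [Ring S] (G : ModuleCat.{u} R ⥤ ModuleCat.{u} S) :
    IsoClass.{u} R → IsoClass.{u} S :=
  Quotient.map G.obj fun _ _ ⟨f⟩ => ⟨G.mapIso f⟩

open ModuleCat in
/-- The component `M_j = e_j M`. -/
def vertexSpace (Q : FinQuiver I A) (lam : I → ℂ) (M : ModuleCat.{u} (Q.Preproj lam)) (j : I) :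
    Submodule ℂ M :=
  LinearMap.range (Algebra.lsmul ℂ ℂ M (Preproj.e Q lam j))

/-- `M` has dimension vector `α`: each `M_j` is finite-dimensional, of dimension `α_j`. -/
def HasDim (Q : FinQuiver I A) (lam : I → ℂ) (M : ModuleCat.{u} (Q.Preproj lam)) (α : I → ℤ) :
    Prop :=
  ∀ j, Module.Finite ℂ (Q.vertexSpace lam M j) ∧ (Module.finrank ℂ (Q.vertexSpace lam M j) : ℤ) = α j

/-- The set of points of the quiver variety `M_Q(λ, α)`: the isomorphism classes of
`Π^λ(Q)`-modules with dimension vector `α`. -/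
def quiverVariety (Q : FinQuiver I A) (lam : I → ℂ) (α : I → ℤ) : Set (IsoClass.{u} (Q.Preproj lam)) :=
  {x | ∃ M, Q.HasDim lam M α ∧ isoClass M = x}

/-- The isomorphism classes of indecomposable projective modules. -/
def indecProj (R : Type) [Ring R] : Set (IsoClass.{u} R) :=
  {x | ∃ M : ModuleCat.{u} R, Module.Projective R M ∧ Indecomposable M ∧ isoClass M = x}

end FinQuiver

end

noncomputable section

namespace FinQuiver

variable {I A : Type} [Fintype I] [DecidableEq I] [Fintype A] [DecidableEq A]

/-! ### Homomorphisms of modules over deformed preprojective algebras -/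

/-! Write `π : ⨁ M_{src c} → M_i` for the signed sum of the arrows `c` ending at `i`, and `μ` for
the map back with components `c*`. The preprojective relation at `i` says `πμ = λ_i`. Reflection
replaces `M_i` by `ker π`, and the new arrows into `i` assemble to `μπ - λ_i`. Hence a second
reflection puts `ker (μπ - λ_i)` at `i`, which for `λ_i ≠ 0` is the image of `M_i` under the
injective map `μ`. So `E_i E_i ≅ id`, and `E_i` is an equivalence (`twiceIso`, `reflEquivalence`).
It therefore preserves indecomposable projectives, and rank-nullity for the surjection `π` shows
that it acts on dimension vectors by `s_i`.

The functor `F` is `M ↦ Π ⊗_B e_∞ M` followed by `Hom_Π(Π/(e_∞), -)`, and `E_i` is moved past each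
factor by a universal property. The map `Π ⊗_B e_∞ M → M` is the colocalization at the homomorphisms
that are bijective on `e_∞`-parts. Since `i ≠ ∞`, reflection leaves `e_∞ M` alone, so `E_i` and its
inverse preserve this class and carry colocalizations to colocalizations
(`nonempty_cornerTensor_iso`). The second factor is right adjoint to inflation along `Π → Π/(e_∞) ≅
Π^λ(Q)`. Inflation commutes with reflection because an inflated module vanishes at `∞`, so a
possible extra arrow `∞ → i` contributes nothing (`inflateReflIso`). Uniqueness of adjoints does the
rest (`nonempty_rightAdjoint_iso`).

For words, `r_i` is dual to `s_i` and `s_i` permutes real roots. Regularity thus persists along a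
word, every letter meets a nonzero coordinate, and induction on the word applies. -/

/-- An additive map that commutes with the scalars, the vertices and the arrows is a homomorphism of
modules. -/
def homOfGen {Q : FinQuiver I A} {lam : I → ℂ} {M N : Type*} [AddCommGroup M] [AddCommGroup N]
    [Module (Q.Preproj lam) M] [Module (Q.Preproj lam) N] (f : M →+ N)
    (hc : ∀ (t : ℂ) m, f (algebraMap ℂ (Q.Preproj lam) t • m)
      = algebraMap ℂ (Q.Preproj lam) t • f m)
    (he : ∀ j m, f (Preproj.e Q lam j • m) = Preproj.e Q lam j • f m)
    (ha : ∀ d m, f (Preproj.arr Q lam d • m) = Preproj.arr Q lam d • f m) :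
    M →ₗ[Q.Preproj lam] N where
  __ := f
  map_smul' r m := by
    change f (r • m) = r • f m
    induction r using Preproj.induction generalizing m with
    | hc t => exact hc t m
    | he j => exact he j m
    | ha d => exact ha d m
    | hm x y hx hy => rw [mul_smul, hx, hy, mul_smul]
    | hs x y hx hy => rw [add_smul, map_add, hx, hy, add_smul]

/-! ### Elements of the reflection of a module -/

section ReflElements

open ModuleCat Preproj

variable {Q : FinQuiver I A} {i : I} (h : Q.LoopFree i) {lam lam' : I → ℂ}
  (hlam : lam' = Q.reflParam i lam) {M : ModuleCat.{u} (Q.Preproj lam)}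

/-- The pair underlying an element of the reflection of `M`. -/
def reflVal : (Q.reflFunctor h hlam).obj M →+ M × (Q.Into i → M) where
  toFun p := (show reflSpace Q lam i M from p).1
  map_zero' := rfl
  map_add' _ _ := rfl

theorem reflVal_injective : Function.Injective (reflVal h hlam (M := M)) :=
  fun _ _ hxy => Subtype.ext hxy

theorem reflVal_mem (p : (Q.reflFunctor h hlam).obj M) :
    reflVal h hlam p ∈ reflSpace Q lam i M :=
  (show reflSpace Q lam i M from p).2

/-- The element of the reflection of `M` with a given underlying pair. -/
def reflMk (p : M × (Q.Into i → M)) (hp : p ∈ reflSpace Q lam i M) :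
    (Q.reflFunctor h hlam).obj M :=
  (⟨p, hp⟩ : reflSpace Q lam i M)

theorem reflVal_reflMk (p : M × (Q.Into i → M)) (hp : p ∈ reflSpace Q lam i M) :
    reflVal h hlam (reflMk h hlam p hp) = p := rfl

/-- Together with `reflVal_injective`, this and the next three lemmas reduce identities in a
reflection to computations with `vertexMap` and `dartMap` on pairs. -/
theorem reflVal_e (j : I) (p : (Q.reflFunctor h hlam).obj M) :
    reflVal h hlam (e Q lam' j • p) = vertexMap Q lam i M j (reflVal h hlam p) := by
  change (reflAction Q lam i M h lam' hlam (e Q lam' j) p).1 = _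
  rw [reflAction, Preproj.lift_e]
  rfl

theorem reflVal_arr (d : A ⊕ A) (p : (Q.reflFunctor h hlam).obj M) :
    reflVal h hlam (arr Q lam' d • p) = dartMap Q lam i M d (reflVal h hlam p) := by
  change (reflAction Q lam i M h lam' hlam (arr Q lam' d) p).1 = _
  rw [reflAction, Preproj.lift_arr]
  rfl

theorem reflVal_algebraMap (t : ℂ) (p : (Q.reflFunctor h hlam).obj M) :
    reflVal h hlam (algebraMap ℂ (Q.Preproj lam') t • p) = t • reflVal h hlam p := by
  change (reflAction Q lam i M h lam' hlam (algebraMap ℂ _ t) p).1 = _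
  rw [AlgHom.commutes]
  rfl

theorem reflVal_smul (t : ℂ) (p : (Q.reflFunctor h hlam).obj M) :
    reflVal h hlam (t • p) = t • reflVal h hlam p :=
  reflVal_algebraMap h hlam t p

end ReflElements

/-! ### Reflecting twice -/

section Twice

open ModuleCat Preproj

variable {Q : FinQuiver I A} {i : I} (h : Q.LoopFree i) {lam lam' : I → ℂ}
  (hlam : lam' = Q.reflParam i lam) (hlam' : lam = Q.reflParam i lam')

theorem reflParam_self (h : Q.LoopFree i) (lam : I → ℂ) : Q.reflParam i lam i = - lam i := by
  rw [reflParam, symForm_coord_self h]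
  push_cast
  ring

theorem reflParam_reflParam (h : Q.LoopFree i) (lam : I → ℂ) :
    Q.reflParam i (Q.reflParam i lam) = lam := by
  funext j
  rw [reflParam, reflParam_self h, reflParam]
  ring

/-- The arrow `c*` ends at `src c`, which differs from `i` by loop-freeness. So the components of `μ
m` are vectors to which `reflAway` applies. -/
theorem e_smul_arr_swap (h : Q.LoopFree i) (c : Q.Into i) {M : ModuleCat.{u} (Q.Preproj lam)}
    (m : M) : e Q lam i • arr Q lam c.1.swap • m = 0 := by
  rw [← e_mul_arr, ← mul_smul, ← mul_assoc, tgt_swap,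
    e_mul_ne Q lam (h.src_ne c.2).symm, zero_mul, zero_smul]

theorem arr_swap_smul_e (c : Q.Into i) {M : ModuleCat.{u} (Q.Preproj lam)} (m : M) :
    arr Q lam c.1.swap • e Q lam i • m = arr Q lam c.1.swap • m := by
  have := arr_mul_e Q lam c.1.swap
  rw [src_swap, c.2] at this
  rw [← mul_smul, this]

theorem e_src_smul_arr_swap (c : Q.Into i) {M : ModuleCat.{u} (Q.Preproj lam)} (m : M) :
    e Q lam (Q.src c.1) • arr Q lam c.1.swap • m = arr Q lam c.1.swap • m := by
  have := e_mul_arr Q lam c.1.swap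
  rw [tgt_swap] at this
  rw [← mul_smul, this]

theorem mem_reflSpace_fst {M : ModuleCat.{u} (Q.Preproj lam)} {m : M} (hm : e Q lam i • m = 0) :
    ((m, 0) : M × (Q.Into i → M)) ∈ reflSpace Q lam i M :=
  ⟨hm, fun _ => smul_zero _, by simp⟩

/-- An element of the reflection concentrated away from the vertex `i`. -/
def reflAway {M : ModuleCat.{u} (Q.Preproj lam)} (m : M) (hm : e Q lam i • m = 0) :
    (Q.reflFunctor h hlam).obj M :=
  reflMk h hlam (m, 0) (mem_reflSpace_fst hm)

/-- The new sum map sends `μ m` to `μπμ m - λ_i μ m`, which is zero because `πμ = λ_i` on `M_i`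
(`sum_into_arr`). -/
theorem twice_mem {M : ModuleCat.{u} (Q.Preproj lam)} (m : M) :
    ((reflAway h hlam (m - e Q lam i • m)
        (by rw [smul_sub, ← mul_smul, e_mul_self, sub_self]),
      fun c => reflAway h hlam (arr Q lam c.1.swap • m) (e_smul_arr_swap h c m)) :
      (Q.reflFunctor h hlam).obj M × (Q.Into i → (Q.reflFunctor h hlam).obj M)) ∈
      reflSpace Q lam' i ((Q.reflFunctor h hlam).obj M) := by
  refine ⟨?_, fun c => ?_, ?_⟩
  · apply reflVal_injective h hlam
    rw [reflVal_e, vertexMap_self]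
    rfl
  · apply reflVal_injective h hlam
    rw [reflVal_e, vertexMap_ne Q lam i M (h.src_ne c.2)]
    exact Prod.ext (e_src_smul_arr_swap c m) rfl
  · apply reflVal_injective h hlam
    rw [map_sum, map_zero]
    have : ∀ c : Q.Into i, reflVal h hlam (sgn c.1 • (arr Q lam' c.1 •
        reflAway h hlam (arr Q lam c.1.swap • m) (e_smul_arr_swap h c m))) =
        (0, fun c' => arr Q lam c'.1.swap • (sgn c.1 • (arr Q lam c.1 • arr Q lam c.1.swap • m))
          - if c' = c then lam i • (arr Q lam c.1.swap • m) else 0) := by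
      intro c
      rw [reflVal_smul, reflVal_arr, dartMap_tgt Q lam i M c.2]
      refine Prod.ext (smul_zero _) (funext fun c' => ?_)
      simp only [Prod.smul_snd, Pi.smul_apply, smul_sub, reflAway, reflVal_reflMk]
      congr 1
      · rw [smul_comm (sgn c.1), mul_smul, smul_comm (arr Q lam c.1) (sgn c.1)]
      · by_cases hc : c' = c
        · rw [if_pos hc, if_pos (congrArg Subtype.val hc), e_src_smul_arr_swap, ← mul_smul,
            ← mul_assoc, sgn_mul_self, one_mul]
        · rw [if_neg hc, if_neg (fun hh => hc (Subtype.ext hh)), smul_zero]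
    simp only [this]
    refine Prod.ext ?_ (funext fun c' => ?_)
    · rw [Prod.fst_sum]; simp
    · rw [Prod.snd_sum, Finset.sum_apply]
      simp only [Finset.sum_sub_distrib]
      rw [Finset.sum_ite_eq, if_pos (Finset.mem_univ _), ← Finset.smul_sum, sum_into_arr,
        smul_comm, arr_swap_smul_e, sub_self]
      rfl

/-- The natural map `M → E_i E_i M`. -/
def twiceFun {M : ModuleCat.{u} (Q.Preproj lam)} (m : M) :
    (Q.reflFunctor h hlam').obj ((Q.reflFunctor h hlam).obj M) :=
  reflMk h hlam' _ (twice_mem h hlam m)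

/-- The pair of a reflection of a reflection, expressed with elements of `M`. -/
theorem twice_ext {M : ModuleCat.{u} (Q.Preproj lam)}
    {p q : (Q.reflFunctor h hlam').obj ((Q.reflFunctor h hlam).obj M)}
    (h1 : reflVal h hlam (reflVal h hlam' p).1 = reflVal h hlam (reflVal h hlam' q).1)
    (h2 : ∀ c, reflVal h hlam ((reflVal h hlam' p).2 c)
      = reflVal h hlam ((reflVal h hlam' q).2 c)) : p = q :=
  reflVal_injective h hlam' (Prod.ext (reflVal_injective h hlam h1)
    (funext fun c => reflVal_injective h hlam (h2 c)))

theorem twiceFun_fst {M : ModuleCat.{u} (Q.Preproj lam)} (m : M) :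
    reflVal h hlam (reflVal h hlam' (twiceFun h hlam hlam' m)).1 = (m - e Q lam i • m, 0) := rfl

theorem twiceFun_snd {M : ModuleCat.{u} (Q.Preproj lam)} (m : M) (c : Q.Into i) :
    reflVal h hlam ((reflVal h hlam' (twiceFun h hlam hlam' m)).2 c)
      = (arr Q lam c.1.swap • m, 0) := rfl

/-- The natural homomorphism `M → E_i E_i M`. -/
def twiceHom (M : ModuleCat.{u} (Q.Preproj lam)) :
    M →ₗ[Q.Preproj lam] (Q.reflFunctor h hlam').obj ((Q.reflFunctor h hlam).obj M) :=
  homOfGen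
    { toFun := twiceFun h hlam hlam'
      map_zero' := by
        refine twice_ext h hlam hlam' ?_ fun c => ?_
        · rw [twiceFun_fst]; simp
        · rw [twiceFun_snd]; simp
      map_add' := fun m n => by
        refine twice_ext h hlam hlam' ?_ fun c => ?_
        · simp only [map_add, Prod.fst_add, twiceFun_fst, smul_add]
          refine Prod.ext ?_ (add_zero _).symm
          change _ = _ - _ + (_ - _)
          exact add_sub_add_comm _ _ _ _
        · simp only [map_add, Prod.snd_add, Pi.add_apply, twiceFun_snd, smul_add]
          exact Prod.ext rfl (add_zero _).symm }
    (fun t m => by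
      refine twice_ext h hlam hlam' ?_ fun c => ?_
      · simp only [AddMonoidHom.coe_mk, ZeroHom.coe_mk, Prod.smul_fst,
          reflVal_smul, twiceFun_fst, algebraMap_smul]
        refine Prod.ext ?_ (smul_zero _).symm
        change _ = t • (_ - _)
        rw [smul_sub, smul_comm]
      · simp only [AddMonoidHom.coe_mk, ZeroHom.coe_mk, Prod.smul_snd,
          Pi.smul_apply, reflVal_smul, twiceFun_snd, algebraMap_smul]
        refine Prod.ext ?_ (smul_zero _).symm
        exact smul_comm _ _ _)
    (fun j m => by
      simp only [AddMonoidHom.coe_mk, ZeroHom.coe_mk]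
      by_cases hj : j = i
      · subst hj
        refine twice_ext h hlam hlam' ?_ fun c => ?_
        · rw [reflVal_e, vertexMap_self, twiceFun_fst, ← mul_smul, e_mul_self, sub_self]
          rfl
        · rw [reflVal_e, vertexMap_self, twiceFun_snd, twiceFun_snd, arr_swap_smul_e]
      · refine twice_ext h hlam hlam' ?_ fun c => ?_
        · rw [reflVal_e, vertexMap_ne _ _ _ _ hj, reflVal_e, vertexMap_ne _ _ _ _ hj,
            twiceFun_fst, twiceFun_fst, smul_sub, ← mul_smul, ← mul_smul,
            e_mul_ne _ _ hj, e_mul_ne _ _ (Ne.symm hj)]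
        · rw [reflVal_e, vertexMap_ne _ _ _ _ hj, twiceFun_snd, ← arr_swap_smul_e,
            ← mul_smul (e Q lam i), e_mul_ne _ _ (Ne.symm hj), zero_smul, smul_zero]
          rfl)
    (fun d m => by
      simp only [AddMonoidHom.coe_mk, ZeroHom.coe_mk]
      by_cases hd : Q.tgt d = i
      · have hed : e Q lam i • arr Q lam d • m = arr Q lam d • m := by
          rw [← mul_smul, ← hd, e_mul_arr]
        have hs := h.src_ne hd
        have hda : arr Q lam d • e Q lam i • m = 0 := by
          rw [← arr_mul_e, mul_smul, ← mul_smul (e _ _ _), e_mul_ne _ _ hs, zero_smul, smul_zero]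
        refine twice_ext h hlam hlam' ?_ fun c => ?_
        · rw [reflVal_arr, dartMap_tgt _ _ _ _ hd, twiceFun_fst, hed, sub_self]
          rfl
        · rw [reflVal_arr, dartMap_tgt _ _ _ _ hd, twiceFun_snd, map_sub, mul_smul, reflVal_arr,
            dartMap_src (d := c.1.swap) _ _ _ _ (by rw [tgt_swap]; exact h.src_ne c.2)
              (by rw [src_swap]; exact c.2), reflVal_arr, dartMap_tgt _ _ _ _ hd, twiceFun_fst]
          simp only [Sum.swap_swap, mul_smul, smul_sub, hda]
          by_cases hc : c.1 = d
          · simp only [hc, if_true, reflVal_smul, reflVal_e, vertexMap_ne _ _ _ _ hs,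
              twiceFun_fst, smul_sub]
            have : e Q lam (Q.src d) • e Q lam i • m = 0 := by
              rw [← mul_smul, e_mul_ne _ _ hs, zero_smul]
            simp only [this, sub_zero]
            refine Prod.ext ?_ ?_
            -- At the component `c = d` the inner reflection contributes the correction with `λ_i`
            -- and the outer one the correction with `λ'_i`. They cancel because `λ'_i = -λ_i`.
            · change _ = _ - _ - _
              rw [hlam, reflParam_self h]
              simp
            · simp
          · simp only [hc, if_false, map_zero, smul_zero, sub_zero]
      · by_cases hs : Q.src d = i
        · have h1 : e Q lam i • arr Q lam d • m = 0 := by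
            rw [← e_mul_arr, ← mul_smul, ← mul_assoc, e_mul_ne Q lam (Ne.symm hd), zero_mul,
              zero_smul]
          refine twice_ext h hlam hlam' ?_ fun c => ?_
          · rw [reflVal_arr, dartMap_src _ _ _ _ hd hs, twiceFun_fst, twiceFun_snd, h1, sub_zero,
              Sum.swap_swap]
          · rw [reflVal_arr, dartMap_src _ _ _ _ hd hs, twiceFun_snd, ← arr_swap_smul_e, h1,
              smul_zero]
            rfl
        · have h1 : e Q lam i • arr Q lam d • m = 0 := by
            rw [← e_mul_arr, ← mul_smul, ← mul_assoc, e_mul_ne Q lam (Ne.symm hd), zero_mul,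
              zero_smul]
          have h2 : arr Q lam d • e Q lam i • m = 0 := by
            rw [← arr_mul_e, mul_smul, ← mul_smul (e _ _ _), e_mul_ne _ _ hs, zero_smul,
              smul_zero]
          refine twice_ext h hlam hlam' ?_ fun c => ?_
          · rw [reflVal_arr, dartMap_ne _ _ _ _ hd hs, reflVal_arr, dartMap_ne _ _ _ _ hd hs,
              twiceFun_fst, twiceFun_fst, h1, smul_sub, h2]
          · rw [reflVal_arr, dartMap_ne _ _ _ _ hd hs, twiceFun_snd, ← arr_swap_smul_e, h1,
              smul_zero]
            rfl)

theorem twiceHom_apply (M : ModuleCat.{u} (Q.Preproj lam)) (m : M) :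
    twiceHom h hlam hlam' M m = twiceFun h hlam hlam' m := rfl

/-- A vector killed by all `c*` satisfies `λ_i e_i m = πμ m = 0`, so its part at `i` vanishes; its
other part is visible in the first coordinate. -/
theorem twiceHom_injective (hi : lam i ≠ 0) (M : ModuleCat.{u} (Q.Preproj lam)) :
    Function.Injective (twiceHom h hlam hlam' M) := by
  rw [injective_iff_map_eq_zero]
  intro m hm
  have h1 : m - e Q lam i • m = 0 :=
    congrArg (fun p => (reflVal h hlam (reflVal h hlam' p).1).1) hm
  have h2 : ∀ c : Q.Into i, arr Q lam c.1.swap • m = 0 :=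
    fun c => congrArg (fun p => (reflVal h hlam ((reflVal h hlam' p).2 c)).1) hm
  have h3 := sum_into_arr Q lam i M m
  simp only [h2, smul_zero, Finset.sum_const_zero] at h3
  have h4 : e Q lam i • m = 0 := (smul_eq_zero.1 h3.symm).resolve_left hi
  rwa [h4, sub_zero] at h1

/-- A family `y` in the kernel of the new sum map satisfies `μπ y = λ_i y`, hence `y = μ(λ_i⁻¹ π
y)`. The preimage has part `x` away from `i` and `λ_i⁻¹ π y` at `i`. -/
theorem twiceHom_surjective (hi : lam i ≠ 0) (M : ModuleCat.{u} (Q.Preproj lam)) :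
    Function.Surjective (twiceHom h hlam hlam' M) := by
  intro p
  obtain ⟨h1, h2, h3⟩ := reflVal_mem h hlam' p
  set x := reflVal h hlam (reflVal h hlam' p).1 with hx
  have hx1 : e Q lam i • x.1 = 0 := (reflVal_mem h hlam (reflVal h hlam' p).1).1
  have hx2 : x.2 = 0 := by
    have := congrArg (reflVal h hlam) h1
    rw [reflVal_e, vertexMap_self, ← hx] at this
    exact congrArg Prod.snd this
  set y : Q.Into i → M := fun c => (reflVal h hlam ((reflVal h hlam' p).2 c)).1 with hy
  have hy1 : ∀ c, reflVal h hlam ((reflVal h hlam' p).2 c) = (y c, 0) := by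
    intro c
    have := congrArg (reflVal h hlam) (h2 c)
    rw [reflVal_e, vertexMap_ne _ _ _ _ (h.src_ne c.2)] at this
    exact Prod.ext rfl (congrArg Prod.snd this).symm
  have hy2 : ∀ c, e Q lam (Q.src c.1) • y c = y c := by
    intro c
    have := congrArg (reflVal h hlam) (h2 c)
    rw [reflVal_e, vertexMap_ne _ _ _ _ (h.src_ne c.2)] at this
    exact congrArg Prod.fst (this.trans (hy1 c))
  set s : M := ∑ c : Q.Into i, sgn c.1 • (arr Q lam c.1 • y c) with hs
  have hs1 : e Q lam i • s = s := by
    rw [hs, Finset.smul_sum]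
    refine Finset.sum_congr rfl fun c _ => ?_
    rw [smul_comm, ← mul_smul]
    have := e_mul_arr Q lam c.1
    rw [c.2] at this
    rw [this]
  -- The kernel condition `h3`, read at the component `c`, is `(μπ y)_c = λ_i y_c`.
  have hs2 : ∀ c : Q.Into i, arr Q lam c.1.swap • s = lam i • y c := by
    intro c
    have := congrArg (fun q => (reflVal h hlam q).2 c) h3
    simp only [map_sum, reflVal_smul, reflVal_arr, Prod.snd_sum, Finset.sum_apply, map_zero] at this
    rw [← sub_eq_zero, ← show _ = (0 : M) from this]
    have h5 : ∀ d : Q.Into i, (sgn d.1 • dartMap Q lam i M d.1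
        (reflVal h hlam ((reflVal h hlam' p).2 d))).2 c =
        arr Q lam c.1.swap • (sgn d.1 • (arr Q lam d.1 • y d))
          - if c = d then lam i • y d else 0 := by
      intro d
      rw [hy1, dartMap_tgt _ _ _ _ d.2]
      simp only [Prod.smul_snd, Pi.smul_apply, smul_sub]
      congr 1
      · rw [smul_comm (sgn d.1), mul_smul, smul_comm (arr Q lam d.1) (sgn d.1)]
      · by_cases hc : c = d
        · rw [if_pos hc, if_pos (congrArg Subtype.val hc), hy2, ← mul_smul,
            ← mul_assoc, sgn_mul_self, one_mul]
        · rw [if_neg hc, if_neg (fun hh => hc (Subtype.ext hh)), smul_zero]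
    simp only [h5, Finset.sum_sub_distrib]
    rw [Finset.sum_ite_eq, if_pos (Finset.mem_univ _), ← Finset.smul_sum]
  refine ⟨x.1 + (lam i)⁻¹ • s, twice_ext h hlam hlam' ?_ fun c => ?_⟩
  · rw [twiceHom_apply, twiceFun_fst, ← hx]
    refine Prod.ext ?_ hx2.symm
    dsimp only
    rw [smul_add, hx1, smul_comm, hs1, zero_add, add_sub_cancel_right]
  · rw [twiceHom_apply, twiceFun_snd, hy1]
    refine Prod.ext ?_ rfl
    dsimp only
    rw [smul_add, ← arr_swap_smul_e c x.1, hx1, smul_zero, zero_add, smul_comm, hs2, ← mul_smul,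
      inv_mul_cancel₀ hi, one_smul]

/-- The natural isomorphism `M ≅ E_i E_i M`, for `λ_i ≠ 0`. -/
def twiceIso (hi : lam i ≠ 0) : 𝟭 (ModuleCat.{u} (Q.Preproj lam)) ≅
    Q.reflFunctor h hlam ⋙ Q.reflFunctor h hlam' :=
  NatIso.ofComponents
    (fun M => (LinearEquiv.ofBijective (twiceHom h hlam hlam' M)
      ⟨twiceHom_injective h hlam hlam' hi M, twiceHom_surjective h hlam hlam' hi M⟩).toModuleIso)
    (fun {M N} f => by
      refine ModuleCat.hom_ext (LinearMap.ext fun m => twice_ext h hlam hlam' ?_ fun c => ?_)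
      · refine Prod.ext ?_ (funext fun c => (map_zero f.hom).symm)
        change f.hom m - e Q lam i • f.hom m = f.hom (m - e Q lam i • m)
        rw [map_sub, map_smul]
      · refine Prod.ext ?_ (funext fun c => (map_zero f.hom).symm)
        exact (map_smul f.hom (arr Q lam c.1.swap) m).symm)

/-- The reflection functor at `i` is an equivalence for `λ_i ≠ 0`. -/
def reflEquivalence (hi : lam i ≠ 0) :
    ModuleCat.{u} (Q.Preproj lam) ≌ ModuleCat.{u} (Q.Preproj lam') :=
  CategoryTheory.Equivalence.mk (Q.reflFunctor h hlam)
    -- The inverse is the same reflection, since `r_i` is an involution. The counit is the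
    -- isomorphism for `λ'`, available because `λ'_i = -λ_i` is again nonzero.
    (Q.reflFunctor h (lam' := lam) (by rw [hlam, reflParam_reflParam h]))
    (twiceIso h hlam _ hi)
    (twiceIso h _ hlam (by rw [hlam, reflParam_self h]; exact neg_ne_zero.2 hi)).symm

end Twice

/-! ### Equivalences and isomorphism classes -/

section Classes

variable {R S : Type} [Ring R] [Ring S]

theorem isoClass_eq {M N : ModuleCat.{u} R} (f : M ≅ N) : isoClass M = isoClass N :=
  Quotient.sound ⟨f⟩

theorem onClasses_congr {G G' : ModuleCat.{u} R ⥤ ModuleCat.{u} S} (f : G ≅ G') :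
    onClasses G = onClasses G' := by
  funext x
  induction x using Quotient.inductionOn with
  | h M => exact isoClass_eq (f.app M)

theorem onClasses_comp {T : Type} [Ring T] (G : ModuleCat.{u} R ⥤ ModuleCat.{u} S)
    (H : ModuleCat.{u} S ⥤ ModuleCat.{u} T) (x : IsoClass.{u} R) :
    onClasses (G ⋙ H) x = onClasses H (onClasses G x) := by
  induction x using Quotient.inductionOn with
  | h M => rfl

theorem onClasses_id (x : IsoClass.{u} R) : onClasses (𝟭 (ModuleCat.{u} R)) x = x := by
  induction x using Quotient.inductionOn with
  | h M => rfl

/-- On isomorphism classes the unit and counit become equalities, so the inverse functor gives an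
actual inverse map. -/
theorem bijOn_onClasses (E : ModuleCat.{u} R ≌ ModuleCat.{u} S) {s : Set (IsoClass.{u} R)}
    {t : Set (IsoClass.{u} S)} (h1 : Set.MapsTo (onClasses E.functor) s t)
    (h2 : Set.MapsTo (onClasses E.inverse) t s) : Set.BijOn (onClasses E.functor) s t := by
  refine Set.InvOn.bijOn (f' := onClasses E.inverse) ⟨fun x _ => ?_, fun x _ => ?_⟩ h1 h2
  · rw [← onClasses_comp, ← onClasses_congr E.unitIso, onClasses_id]
  · rw [← onClasses_comp, onClasses_congr E.counitIso, onClasses_id]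

/-- A decomposition of the image pulls back along the inverse, which preserves biproducts, to a
decomposition of `M`; an equivalence also reflects zero objects. -/
theorem indecomposable_functor_obj (E : ModuleCat.{u} R ≌ ModuleCat.{u} S) {M : ModuleCat.{u} R}
    (hM : Indecomposable M) : Indecomposable (E.functor.obj M) := by
  have hz : ∀ N, Limits.IsZero (E.inverse.obj N) → Limits.IsZero N := fun N hN =>
    (Limits.IsZero.of_iso (E.functor.map_isZero hN) (E.counitIso.app N).symm)
  refine ⟨fun h => hM.1 ((E.inverse.map_isZero h).of_iso (E.unitIso.app M)), fun Y Z f => ?_⟩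
  have : Limits.PreservesBinaryBiproduct Y Z E.inverse :=
    Limits.preservesBinaryBiproduct_of_preservesBinaryProduct _
  exact (hM.2 _ _ (E.unitIso.app M ≪≫ E.inverse.mapIso f ≪≫ E.inverse.mapBiprod Y Z)).imp
    (hz Y) (hz Z)

theorem mapsTo_indecProj (E : ModuleCat.{u} R ≌ ModuleCat.{u} S) :
    Set.MapsTo (onClasses E.functor) (indecProj.{u} R) (indecProj.{u} S) := by
  rintro _ ⟨M, h1, h2, rfl⟩
  refine ⟨E.functor.obj M, ?_, indecomposable_functor_obj E h2, rfl⟩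
  -- Projective modules are the projective objects of the category, a notion invariant under
  -- equivalence.
  rw [IsProjective.iff_projective] at h1 ⊢
  exact (E.map_projective_iff M).2 h1

theorem bijOn_indecProj (E : ModuleCat.{u} R ≌ ModuleCat.{u} S) :
    Set.BijOn (onClasses E.functor) (indecProj.{u} R) (indecProj.{u} S) :=
  bijOn_onClasses E (mapsTo_indecProj E) (mapsTo_indecProj E.symm)

end Classes

/-! ### Dimension vectors of reflections -/

theorem sum_into (Q : FinQuiver I A) (i : I) (f : I → ℤ) :
    ∑ c : Q.Into i, f (Q.src c.1) = (∑ a, if Q.head a = i then f (Q.tail a) else 0)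
      + ∑ a, if Q.tail a = i then f (Q.head a) else 0 := by
  have : ∑ d : A ⊕ A, (if Q.tgt d = i then f (Q.src d) else 0) =
      (∑ a, if Q.head a = i then f (Q.tail a) else 0)
        + ∑ a, if Q.tail a = i then f (Q.head a) else 0 := Fintype.sum_sum_type _
  rw [← this, ← Finset.sum_filter]
  exact (Finset.sum_subtype (p := fun d => Q.tgt d = i) _ (by simp) (fun d => f (Q.src d))).symm

theorem symForm_coord_right (Q : FinQuiver I A) (i : I) (α : I → ℤ) :
    Q.symForm α (coord i) = 2 * α i - ∑ c : Q.Into i, α (Q.src c.1) := by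
  rw [sum_into]
  have h1 : ∑ j, α j * coord i j = α i := by simp [coord, Pi.single_apply]
  have h2 : ∑ j, coord i j * α j = α i := by simp [coord, Pi.single_apply]
  have h3 : ∀ a, α (Q.tail a) * coord i (Q.head a) = if Q.head a = i then α (Q.tail a) else 0 := by
    intro a
    simp [coord, Pi.single_apply]
  have h4 : ∀ a, coord i (Q.tail a) * α (Q.head a) = if Q.tail a = i then α (Q.head a) else 0 := by
    intro a
    simp [coord, Pi.single_apply]
  simp only [symForm, ringelForm, h1, h2, h3, h4]
  ring

/-- This is the form of `s_i` that matches rank-nullity: the dimension of the kernel of a surjection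
`⨁ M_{src c} → M_i`. -/
theorem refl_apply_self (Q : FinQuiver I A) (i : I) (α : I → ℤ) :
    Q.refl i α i = ∑ c : Q.Into i, α (Q.src c.1) - α i := by
  rw [refl, Pi.sub_apply, Pi.smul_apply, symForm_coord_right, coord, Pi.single_eq_same,
    smul_eq_mul]
  ring

theorem refl_apply_ne (Q : FinQuiver I A) {i j : I} (hj : j ≠ i) (α : I → ℤ) :
    Q.refl i α j = α j := by
  simp [refl, coord, hj]

section Dim

open ModuleCat Preproj

variable {Q : FinQuiver I A} {i : I} (h : Q.LoopFree i) {lam lam' : I → ℂ}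
  (hlam : lam' = Q.reflParam i lam)

theorem mem_vertexSpace {M : ModuleCat.{u} (Q.Preproj lam)} {j : I} {m : M} :
    m ∈ Q.vertexSpace lam M j ↔ e Q lam j • m = m := by
  constructor
  · rintro ⟨n, rfl⟩
    change e Q lam j • e Q lam j • n = e Q lam j • n
    rw [← mul_smul, e_mul_self]
  · exact fun hm => ⟨m, hm⟩

theorem e_smul_of_mem_ne {M : ModuleCat.{u} (Q.Preproj lam)} {j l : I} (hl : l ≠ j) {m : M}
    (hm : e Q lam j • m = m) : e Q lam l • m = 0 := by
  rw [← hm, ← mul_smul, e_mul_ne Q lam hl, zero_smul]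

/-- Away from the vertex `i`, the reflection at `i` does not change the vertex spaces. -/
def vertexSpaceReflNe (M : ModuleCat.{u} (Q.Preproj lam)) {j : I} (hj : j ≠ i) :
    Q.vertexSpace lam' ((Q.reflFunctor h hlam).obj M) j ≃ₗ[ℂ] Q.vertexSpace lam M j where
  toFun p := ⟨(reflVal h hlam p.1).1, mem_vertexSpace.2 (by
    have := congrArg (fun q => (reflVal h hlam q).1) (mem_vertexSpace.1 p.2)
    simpa only [reflVal_e, vertexMap_ne _ _ _ _ hj] using this)⟩
  map_add' _ _ := rfl
  map_smul' t p := Subtype.ext (congrArg Prod.fst (reflVal_smul h hlam t p.1))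
  invFun m := ⟨reflAway h hlam m.1 (e_smul_of_mem_ne hj.symm (mem_vertexSpace.1 m.2)),
    mem_vertexSpace.2 (reflVal_injective h hlam (by
      rw [reflVal_e, vertexMap_ne _ _ _ _ hj]
      exact Prod.ext (mem_vertexSpace.1 m.2) rfl))⟩
  left_inv p := Subtype.ext (reflVal_injective h hlam (by
    have := congrArg (fun q => (reflVal h hlam q).2) (mem_vertexSpace.1 p.2)
    simp only [reflVal_e, vertexMap_ne _ _ _ _ hj] at this
    exact Prod.ext rfl this))
  right_inv _ := rfl

/-- The map `π = ∑ ± c : ⨁_{c ending at i} M_{src c} → M_i`. -/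
def vertexSum (M : ModuleCat.{u} (Q.Preproj lam)) (i : I) :
    (∀ c : Q.Into i, Q.vertexSpace lam M (Q.src c.1)) →ₗ[ℂ] Q.vertexSpace lam M i where
  toFun y := ⟨∑ c, sgn c.1 • (arr Q lam c.1 • (y c : M)), mem_vertexSpace.2 (by
    rw [Finset.smul_sum]
    refine Finset.sum_congr rfl fun c _ => ?_
    rw [smul_comm, ← mul_smul]
    have := e_mul_arr Q lam c.1
    rw [c.2] at this
    rw [this])⟩
  map_add' x y := Subtype.ext (by
    simp [Finset.sum_add_distrib, smul_add])
  map_smul' t y := Subtype.ext (by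
    simp only [Pi.smul_apply, Submodule.coe_smul, RingHom.id_apply, Finset.smul_sum]
    refine Finset.sum_congr rfl fun c _ => ?_
    rw [smul_comm (arr Q lam c.1) t, smul_comm (sgn c.1) t])

/-- The relation `πμ = λ_i` makes `λ_i⁻¹ μ` a section of `π`. -/
theorem vertexSum_surjective (hi : lam i ≠ 0)
    (M : ModuleCat.{u} (Q.Preproj lam)) : Function.Surjective (vertexSum M i) := by
  rintro ⟨m, hm⟩
  rw [mem_vertexSpace] at hm
  refine ⟨(lam i)⁻¹ • fun c => ⟨arr Q lam c.1.swap • m, mem_vertexSpace.2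
    (e_src_smul_arr_swap c m)⟩, ?_⟩
  rw [map_smul]
  refine Subtype.ext ?_
  change (lam i)⁻¹ • ∑ c : Q.Into i, sgn c.1 • (arr Q lam c.1 • arr Q lam c.1.swap • m) = m
  rw [sum_into_arr, hm, ← mul_smul, inv_mul_cancel₀ hi, one_smul]

/-- The vertex space at `i` of the reflection at `i` is the kernel of `π`. -/
def vertexSpaceReflSelf (M : ModuleCat.{u} (Q.Preproj lam)) :
    Q.vertexSpace lam' ((Q.reflFunctor h hlam).obj M) i ≃ₗ[ℂ] LinearMap.ker (vertexSum M i) where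
  toFun p := ⟨fun c => ⟨(reflVal h hlam p.1).2 c,
    mem_vertexSpace.2 ((reflVal_mem h hlam p.1).2.1 c)⟩,
    Subtype.ext (reflVal_mem h hlam p.1).2.2⟩
  map_add' _ _ := rfl
  map_smul' t p := Subtype.ext (funext fun c =>
    Subtype.ext (congrArg (fun q => q.2 c) (reflVal_smul h hlam t p.1)))
  invFun y := ⟨reflMk h hlam (0, fun c => (y.1 c : M)) ⟨smul_zero _,
      fun c => mem_vertexSpace.1 (y.1 c).2, congrArg Subtype.val y.2⟩,
    mem_vertexSpace.2 (reflVal_injective h hlam (by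
      rw [reflVal_e, vertexMap_self]
      rfl))⟩
  left_inv p := Subtype.ext (reflVal_injective h hlam (by
    have := congrArg (fun q => (reflVal h hlam q).1) (mem_vertexSpace.1 p.2)
    simp only [reflVal_e, vertexMap_self] at this
    exact Prod.ext this rfl))
  right_inv _ := rfl

/-- Only the space at `i` changes. It becomes `ker π`, and `π` is onto, so rank-nullity gives the
coordinate found in `refl_apply_self`. -/
theorem HasDim.refl (hi : lam i ≠ 0) {M : ModuleCat.{u} (Q.Preproj lam)} {α : I → ℤ}
    (hM : Q.HasDim lam M α) : Q.HasDim lam' ((Q.reflFunctor h hlam).obj M) (Q.refl i α) := by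
  intro j
  have hf : ∀ j, Module.Finite ℂ (Q.vertexSpace lam M j) := fun j => (hM j).1
  by_cases hj : j = i
  · subst hj
    refine ⟨Module.Finite.equiv (vertexSpaceReflSelf h hlam M).symm, ?_⟩
    rw [(vertexSpaceReflSelf h hlam M).finrank_eq, refl_apply_self]
    have h1 := (vertexSum M j).finrank_range_add_finrank_ker
    rw [LinearMap.range_eq_top.2 (vertexSum_surjective hi M), finrank_top,
      Module.finrank_pi_fintype] at h1
    have h2 := congrArg (Nat.cast : ℕ → ℤ) h1
    push_cast at h2
    simp only [(hM _).2] at h2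
    linarith
  · refine ⟨Module.Finite.equiv (vertexSpaceReflNe h hlam M hj).symm, ?_⟩
    rw [(vertexSpaceReflNe h hlam M hj).finrank_eq, (hM j).2, refl_apply_ne Q hj]

theorem bijOn_quiverVariety (hi : lam i ≠ 0) (α : I → ℤ) :
    Set.BijOn (onClasses (Q.reflFunctor h hlam)) (Q.quiverVariety.{u} lam α)
      (Q.quiverVariety.{u} lam' (Q.refl i α)) := by
  refine bijOn_onClasses (reflEquivalence h hlam hi) ?_ ?_
  · rintro _ ⟨M, hM, rfl⟩
    exact ⟨_, hM.refl h hlam hi, rfl⟩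
  · rintro _ ⟨M, hM, rfl⟩
    have hi' : lam' i ≠ 0 := by
      rw [hlam, reflParam_self h]
      exact neg_ne_zero.2 hi
    have := hM.refl h (lam' := lam) (by rw [hlam, reflParam_reflParam h]) hi'
    -- Reflecting back a module of dimension `s_i α` gives dimension `s_i s_i α = α`.
    rw [Q.refl_involutive h] at this
    exact ⟨_, this, rfl⟩

end Dim

/-! ### The functor `R ⊗_B e(-)` as a colocalization -/

/-- Two functors over `T` that are colocalizations with respect to `W` are isomorphic. -/
theorem nonempty_iso_of_colocal {C D : Type*} [Category C] [Category D] {K₁ K₂ T : C ⥤ D}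
    (W : MorphismProperty D) (a₁ : K₁ ⟶ T) (a₂ : K₂ ⟶ T) (h₁ : ∀ X, W (a₁.app X))
    (h₂ : ∀ X, W (a₂.app X))
    (l₁ : ∀ X ⦃Y Z : D⦄ (f : Y ⟶ Z), W f → ∀ g : K₁.obj X ⟶ Z, ∃! g' : K₁.obj X ⟶ Y, g' ≫ f = g)
    (l₂ : ∀ X ⦃Y Z : D⦄ (f : Y ⟶ Z), W f → ∀ g : K₂.obj X ⟶ Z, ∃! g' : K₂.obj X ⟶ Y, g' ≫ f = g) :
    Nonempty (K₁ ≅ K₂) := by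
  -- Each counit lies in `W`, so it can be lifted through the other one. The lifts are mutually
  -- inverse and natural because in each case both candidates lift the same map through a morphism
  -- of `W`.
  choose u hu _ using fun X => l₁ X _ (h₂ X) (a₁.app X)
  choose v hv _ using fun X => l₂ X _ (h₁ X) (a₂.app X)
  refine ⟨NatIso.ofComponents (fun X => ⟨u X, v X, ?_, ?_⟩) fun {X Y} f => ?_⟩
  · exact (l₁ X _ (h₁ X) (a₁.app X)).unique (by rw [Category.assoc, hv, hu]) (Category.id_comp _)
  · exact (l₂ X _ (h₂ X) (a₂.app X)).unique (by rw [Category.assoc, hu, hv]) (Category.id_comp _)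
  · refine (l₁ X _ (h₂ Y) (K₁.map f ≫ a₁.app Y)).unique ?_ ?_
    · rw [Category.assoc, hu]
    · rw [Category.assoc, a₂.naturality, ← Category.assoc, hu, a₁.naturality]

section Corner

variable {R : Type} [Ring R] (e : R)

/-- The homomorphisms `f : M → N` that induce a bijection `eM → eN`. -/
def cornerIsos : MorphismProperty (ModuleCat.{u} R) :=
  fun _ N f => ∀ y : N, e • y = y → ∃! x, e • x = x ∧ f.hom x = y

variable {e} {M N : ModuleCat.{u} R}

/-- The class of `r ⊗ n` in `R ⊗_B eM`. -/
def cornerMk (r : R) (n : cornerPart R e M) : (cornerTensor R e).obj M :=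
  (balancedRel R e M).mkQ (r ⊗ₜ[ℤ] n)

theorem smul_cornerMk (s r : R) (n : cornerPart R e M) :
    s • cornerMk r n = cornerMk (s * r) n := rfl

theorem cornerMk_add (r : R) (n n' : cornerPart R e M) :
    cornerMk r (n + n') = cornerMk r n + cornerMk r n' := by
  rw [cornerMk, TensorProduct.tmul_add, map_add]
  rfl

theorem cornerMk_balanced (r p : R) (n : cornerPart R e M) :
    cornerMk (r * (e * p * e)) n = cornerMk r (cornerSMul R e M p n) := by
  refine (Submodule.Quotient.eq _).2 (Submodule.subset_span ⟨r, p, n, rfl⟩)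

theorem cornerTensor_induction {P : (cornerTensor R e).obj M → Prop} (h0 : P 0)
    (hm : ∀ r n, P (cornerMk r n)) (ha : ∀ x y, P x → P y → P (x + y)) (x) : P x := by
  obtain ⟨x, rfl⟩ := (balancedRel R e M).mkQ_surjective x
  induction x with
  | zero => rw [map_zero]; exact h0
  | tmul r n => exact hm r n
  | add x y hx hy => rw [map_add]; exact ha _ _ hx hy

/-- The elements `1 ⊗ n` generate `R ⊗_B eM` as an `R`-module. -/
theorem cornerTensor_hom_ext {f g : (cornerTensor R e).obj M ⟶ N}
    (h : ∀ n, f.hom (cornerMk 1 n) = g.hom (cornerMk 1 n)) : f = g := by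
  refine ModuleCat.hom_ext (LinearMap.ext fun x => ?_)
  induction x using cornerTensor_induction with
  | h0 => rw [map_zero, map_zero]
  | hm r n => rw [← mul_one r, ← smul_cornerMk, map_smul, map_smul, h]
  | ha x y hx hy => rw [map_add, map_add, hx, hy]

/-- The homomorphism `R ⊗_B eM → N` given by a `B`-linear map `eM → N`. -/
def cornerLift (φ : cornerPart R e M →+ N)
    (hφ : ∀ p n, φ (cornerSMul R e M p n) = (e * p * e) • φ n) :
    (cornerTensor R e).obj M ⟶ N :=
  ModuleCat.ofHom ((balancedRel R e M).liftQ
    (TensorProduct.AlgebraTensorModule.lift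
      (LinearMap.toSpanSingleton R (cornerPart R e M →ₗ[ℤ] N) φ.toIntLinearMap)) (by
    rw [balancedRel, Submodule.span_le]
    rintro _ ⟨r, p, n, rfl⟩
    rw [SetLike.mem_coe, LinearMap.mem_ker, map_sub, sub_eq_zero]
    change (r * (e * p * e)) • φ n = r • φ (cornerSMul R e M p n)
    rw [hφ, mul_smul]))

variable (e) in
/-- The natural map `R ⊗_B eM → M`. -/
def cornerCounit : cornerTensor.{u} R e ⟶ 𝟭 (ModuleCat.{u} R) where
  app M := cornerLift (N := M) (cornerPart R e M).subtype fun _ _ => rfl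
  naturality M N f := by
    refine cornerTensor_hom_ext fun n => ?_
    change (1 : R) • f.hom n = f.hom ((1 : R) • (n : M))
    rw [map_smul]

variable (he : e * e = e)
include he

theorem cornerSMul_one (n : cornerPart R e M) : cornerSMul R e M 1 n = n := by
  obtain ⟨_, m, rfl⟩ := n
  refine Subtype.ext ?_
  change (e * 1 * e) • e • m = e • m
  rw [mul_one, he, ← mul_smul, he]

/-- Since `n = e n`, the tensor `er ⊗ n` equals `ere ⊗ n`, and `ere` lies in `B` and passes to the
right factor. -/
theorem smul_cornerMk_eq (r : R) (n : cornerPart R e M) :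
    e • cornerMk r n = cornerMk 1 (cornerSMul R e M r n) := by
  rw [← cornerMk_balanced, one_mul, smul_cornerMk]
  conv_lhs => rw [← cornerSMul_one he n, ← cornerMk_balanced, mul_one, he]

theorem smul_cornerMk_one (n : cornerPart R e M) : e • cornerMk 1 n = cornerMk 1 n := by
  rw [smul_cornerMk_eq he, cornerSMul_one he]

/-- Every element of `e(R ⊗_B eM)` is thus a pure tensor `1 ⊗ n`, which is what makes the counit
injective on `e`-parts. -/
theorem exists_cornerMk_one (x : (cornerTensor R e).obj M) : ∃ n, e • x = cornerMk 1 n := by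
  induction x using cornerTensor_induction with
  | h0 =>
    refine ⟨0, ?_⟩
    rw [smul_zero, cornerMk, TensorProduct.tmul_zero, map_zero]
    rfl
  | hm r n => exact ⟨_, smul_cornerMk_eq he r n⟩
  | ha x y hx hy =>
    obtain ⟨n, hn⟩ := hx
    obtain ⟨n', hn'⟩ := hy
    exact ⟨n + n', by rw [smul_add, hn, hn', cornerMk_add]⟩

theorem cornerIsos_cornerCounit (M : ModuleCat.{u} R) :
    cornerIsos e ((cornerCounit e).app M) := by
  intro y hy
  have h1 : ∀ n : cornerPart R e M, ((cornerCounit e).app M).hom (cornerMk 1 n) = (n : M) :=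
    fun n => one_smul R (n : M)
  refine ⟨cornerMk 1 ⟨y, y, hy⟩, ⟨smul_cornerMk_one he _, h1 _⟩, ?_⟩
  rintro x ⟨hx, hxy⟩
  obtain ⟨n, hn⟩ := exists_cornerMk_one he x
  rw [← hx, hn]
  congr 1
  refine Subtype.ext ?_
  rw [← h1 n, ← hn, hx, hxy]

/-- Homomorphisms `R ⊗_B eM → X` correspond to `B`-linear maps `eM → eX`, so they see only `eX`, and
`f` identifies `eX` with `eY`. -/
theorem cornerTensor_existsUnique_lift (M : ModuleCat.{u} R) ⦃X Y : ModuleCat.{u} R⦄ (f : X ⟶ Y)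
    (hf : cornerIsos e f) (g : (cornerTensor R e).obj M ⟶ Y) :
    ∃! g' : (cornerTensor R e).obj M ⟶ X, g' ≫ f = g := by
  have hg : ∀ n, e • g.hom (cornerMk 1 n) = g.hom (cornerMk 1 n) := fun n => by
    rw [← map_smul, smul_cornerMk_one he]
  -- `φ n` is the unique element of `eX` above `g(1 ⊗ n)`. This uniqueness forces `φ` to be additive
  -- and `B`-linear.
  choose φ hφ hu using fun n => hf _ (hg n)
  have hadd : ∀ n n', φ (n + n') = φ n + φ n' := fun n n' =>
    (hu _ _ ⟨by rw [smul_add, (hφ n).1, (hφ n').1],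
      by rw [map_add, (hφ n).2, (hφ n').2, ← map_add, ← cornerMk_add]⟩).symm
  refine ⟨cornerLift (AddMonoidHom.mk' φ hadd) fun p n => (hu _ _ ⟨?_, ?_⟩).symm, ?_, ?_⟩
  · change e • (e * p * e) • φ n = (e * p * e) • φ n
    rw [← mul_smul, ← mul_assoc, ← mul_assoc, he]
  · change f.hom ((e * p * e) • φ n) = _
    rw [map_smul, (hφ n).2, ← map_smul, smul_cornerMk, mul_one, ← cornerMk_balanced, one_mul]
  · refine cornerTensor_hom_ext fun n => ?_
    exact (congrArg f.hom (one_smul R (φ n))).trans (hφ n).2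
  · rintro g' rfl
    refine cornerTensor_hom_ext fun n => ?_
    exact (hu n _ ⟨by rw [← map_smul, smul_cornerMk_one he], rfl⟩).trans (one_smul R (φ n)).symm

/-- An equivalence of module categories that respects the corners commutes with the functors
`R ⊗_B e(-)`. -/
theorem nonempty_cornerTensor_iso {S : Type} [Ring S] {e' : S} (he' : e' * e' = e')
    (E : ModuleCat.{u} R ≌ ModuleCat.{u} S)
    (h1 : ∀ ⦃X Y : ModuleCat.{u} R⦄ (f : X ⟶ Y), cornerIsos e f → cornerIsos e' (E.functor.map f))
    (h2 : ∀ ⦃X Y : ModuleCat.{u} S⦄ (f : X ⟶ Y), cornerIsos e' f → cornerIsos e (E.inverse.map f)) :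
    Nonempty (E.functor ⋙ cornerTensor S e' ≅ cornerTensor R e ⋙ E.functor) := by
  -- Both composites are colocalizations of `E.functor` with respect to `cornerIsos e'`; only the
  -- lifting property of `E(R ⊗_B eX)` needs an argument.
  refine nonempty_iso_of_colocal (T := E.functor) (cornerIsos e')
    (Functor.whiskerLeft E.functor (cornerCounit e'))
    (Functor.whiskerRight (cornerCounit e) E.functor)
    (fun X => cornerIsos_cornerCounit he' _) (fun X => h1 _ (cornerIsos_cornerCounit he X))
    (fun X => cornerTensor_existsUnique_lift he' _) fun X Y Z f hf g => ?_
  let adj := E.toAdjunction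
  -- The lifting problem is moved across the adjunction to one for `R ⊗_B eX` against `E.inverse.map
  -- f`, which lies in `cornerIsos e`.
  obtain ⟨g', hg', hu⟩ := cornerTensor_existsUnique_lift he X _ (h2 f hf) (adj.homEquiv _ _ g)
  refine ⟨(adj.homEquiv _ _).symm g', ?_, fun g'' hg'' => ?_⟩
  · apply (adj.homEquiv _ _).injective
    rw [← hg', adj.homEquiv_naturality_right, Equiv.apply_symm_apply]
  · rw [Equiv.eq_symm_apply]
    refine hu _ ?_
    change _ ≫ E.inverse.map f = _
    rw [← hg'', adj.homEquiv_naturality_right]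

end Corner

/-! ### Reflection functors and corners at other vertices -/

section ReflCorner

open ModuleCat Preproj

variable {Q : FinQuiver I A} {i : I} (h : Q.LoopFree i) {lam lam' : I → ℂ}
  (hlam : lam' = Q.reflParam i lam)

/-- For `j ≠ i` the `e_j`-part of the reflection of `M` is `e_j M`, embedded by `reflAway`, and the
induced map on it is that of `f`. -/
theorem cornerIsos_reflFunctor_map {j : I} (hj : j ≠ i) {X Y : ModuleCat.{u} (Q.Preproj lam)}
    (f : X ⟶ Y) (hf : cornerIsos (e Q lam j) f) :
    cornerIsos (e Q lam' j) ((Q.reflFunctor h hlam).map f) := by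
  have key : ∀ {Z : ModuleCat.{u} (Q.Preproj lam)} {z : (Q.reflFunctor h hlam).obj Z},
      e Q lam' j • z = z → e Q lam j • (reflVal h hlam z).1 = (reflVal h hlam z).1 ∧
        (reflVal h hlam z).2 = 0 := by
    intro Z z hz
    have := congrArg (reflVal h hlam) hz
    rw [reflVal_e, vertexMap_ne _ _ _ _ hj] at this
    exact ⟨congrArg Prod.fst this, (congrArg Prod.snd this).symm⟩
  intro y hy
  obtain ⟨hy1, hy2⟩ := key hy
  obtain ⟨x, ⟨hx1, hx2⟩, hu⟩ := hf _ hy1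
  refine ⟨reflAway h hlam x (e_smul_of_mem_ne hj.symm hx1), ⟨?_, ?_⟩, ?_⟩
  · apply reflVal_injective h hlam
    rw [reflVal_e, vertexMap_ne _ _ _ _ hj]
    exact Prod.ext hx1 rfl
  · apply reflVal_injective h hlam
    refine Prod.ext hx2 ?_
    rw [hy2]
    exact funext fun c => map_zero f.hom
  · rintro x' ⟨hx1', hx2'⟩
    obtain ⟨h1, h2⟩ := key hx1'
    apply reflVal_injective h hlam
    exact Prod.ext (hu _ ⟨h1, congrArg (fun z => (reflVal h hlam z).1) hx2'⟩) h2

/-- The inverse of the equivalence is itself a reflection at `i`, so one lemma on corners serves in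
both directions. -/
theorem nonempty_cornerTensor_reflFunctor_iso {j : I} (hj : j ≠ i) (hi : lam i ≠ 0) :
    Nonempty (Q.reflFunctor h hlam ⋙ cornerTensor.{u} _ (e Q lam' j) ≅
      cornerTensor.{u} _ (e Q lam j) ⋙ Q.reflFunctor h hlam) :=
  nonempty_cornerTensor_iso (e_mul_self Q lam j) (e_mul_self Q lam' j)
    (reflEquivalence h hlam hi)
    (fun _ _ f hf => cornerIsos_reflFunctor_map h hlam hj f hf)
    (fun _ _ f hf => cornerIsos_reflFunctor_map h _ hj f hf)

end ReflCorner

/-! ### Inflation along `Π^{λ_α}(Q_∞) → Π^λ(Q)` -/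

section Inflation

open ModuleCat Preproj

variable (Q : FinQuiver I A) (k : I) (lam : I → ℂ) (η : I → ℤ)

/-- The homomorphism `Π^{λ_α}(Q_∞) → Π^λ(Q)` that kills `e_∞`. -/
def fromFramed : Q.FramedPreproj k lam η →ₐ[ℂ] Q.Preproj lam :=
  Preproj.lift (Q.framed k) (framedParam lam η)
    (fun j => j.elim 0 (e Q lam))
    (Sum.elim (fun a => a.elim 0 fun a => arr Q lam (.inl a))
      (fun a => a.elim 0 fun a => arr Q lam (.inr a)))
    (by
      rintro (_ | j)
      · exact mul_zero _
      · exact e_mul_self Q lam j)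
    (by
      rintro (_ | j) (_ | l) hjl
      · exact mul_zero _
      · exact zero_mul _
      · exact mul_zero _
      · exact e_mul_ne Q lam fun hh => hjl (congrArg some hh))
    (by
      rw [Fintype.sum_option]
      exact (zero_add _).trans (sum_e Q lam))
    (by
      rintro ((_ | a) | (_ | a))
      · exact mul_zero _
      · exact e_mul_arr Q lam (.inl a)
      · exact mul_zero _
      · exact e_mul_arr Q lam (.inr a))
    (by
      rintro ((_ | a) | (_ | a))
      · exact zero_mul _
      · exact arr_mul_e Q lam (.inl a)
      · exact zero_mul _
      · exact arr_mul_e Q lam (.inr a))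
    (by
      rw [Fintype.sum_option, Fintype.sum_option]
      simp only [Sum.elim_inl, Sum.elim_inr, Option.elim_none, Option.elim_some, mul_zero,
        sub_zero, smul_zero, zero_add]
      exact Preproj.preproj Q lam)

theorem fromFramed_e_none : fromFramed Q k lam η (Q.eInf k lam η) = 0 :=
  Preproj.lift_e ..

theorem fromFramed_e_some (j : I) :
    fromFramed Q k lam η (e (Q.framed k) _ (some j)) = e Q lam j :=
  Preproj.lift_e ..

theorem fromFramed_arr_none {d : Option A ⊕ Option A} (hd : d = .inl none ∨ d = .inr none) :
    fromFramed Q k lam η (arr (Q.framed k) _ d) = 0 := by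
  rw [fromFramed, Preproj.lift_arr]
  obtain rfl | rfl := hd <;> rfl

theorem fromFramed_arr_some (d : A ⊕ A) :
    fromFramed Q k lam η (arr (Q.framed k) _ (d.map some some)) = arr Q lam d := by
  rw [fromFramed, Preproj.lift_arr]
  cases d <;> rfl

theorem toQuot_e (j : I) :
    toQuot Q k lam η (e Q lam j) = quotMap Q k lam η (e (Q.framed k) _ (some j)) :=
  Preproj.lift_e ..

theorem toQuot_arr (d : A ⊕ A) :
    toQuot Q k lam η (arr Q lam d) = quotMap Q k lam η (arr (Q.framed k) _ (d.map some some)) :=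
  Preproj.lift_arr ..

/-- Checked on generators: those at `∞` die on both sides and the others agree by definition. This
shows that `toQuot` is onto, and `fromQuot_toQuot` that it is injective. -/
theorem toQuot_fromFramed (x : Q.FramedPreproj k lam η) :
    toQuot Q k lam η (fromFramed Q k lam η x) = quotMap Q k lam η x := by
  induction x using Preproj.induction with
  | hc t => rw [AlgHom.commutes, AlgHom.commutes, AlgHom.commutes]
  | he j =>
    cases j with
    | none => rw [fromFramed_e_none, quotMap_eInf, map_zero]
    | some j => rw [fromFramed_e_some, toQuot_e]
  | ha d =>
    -- Both arrows at `∞` factor through `e_∞`, one on the right and one on the left.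
    have hn : ∀ d : Option A ⊕ Option A, (d = .inl none ∨ d = .inr none) →
        quotMap Q k lam η (arr (Q.framed k) _ d) = 0 := by
      rintro _ (rfl | rfl)
      · rw [← arr_mul_e, map_mul]
        exact (congrArg _ (quotMap_eInf Q k lam η)).trans (mul_zero _)
      · rw [← e_mul_arr, map_mul]
        exact (congrArg (· * _) (quotMap_eInf Q k lam η)).trans (zero_mul _)
    have hs : ∀ d : A ⊕ A, toQuot Q k lam η (fromFramed Q k lam η
        (arr (Q.framed k) _ (d.map some some))) =
          quotMap Q k lam η (arr (Q.framed k) _ (d.map some some)) := by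
      intro d
      rw [fromFramed_arr_some, toQuot_arr]
    rcases d with (_ | a) | (_ | a)
    · rw [fromFramed_arr_none _ _ _ _ (.inl rfl), hn _ (.inl rfl), map_zero]
    · exact hs (.inl a)
    · rw [fromFramed_arr_none _ _ _ _ (.inr rfl), hn _ (.inr rfl), map_zero]
    · exact hs (.inr a)
  | hm x y hx hy => rw [map_mul, map_mul, map_mul, hx, hy]
  | hs x y hx hy => rw [map_add, map_add, map_add, hx, hy]

/-- The homomorphism `Π^{λ_α}(Q_∞)/(e_∞) → Π^λ(Q)`. -/
def fromQuot : IdemQuot (Q.FramedPreproj k lam η) (Q.eInf k lam η) →+* Q.Preproj lam :=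
  RingCon.lift _ (fromFramed Q k lam η).toRingHom (by
    intro x y hxy
    have h1 : TwoSidedIdeal.span {Q.eInf k lam η} ≤
        TwoSidedIdeal.ker (fromFramed Q k lam η).toRingHom := by
      rw [TwoSidedIdeal.span_le, Set.singleton_subset_iff]
      exact (TwoSidedIdeal.mem_ker _).2 (fromFramed_e_none Q k lam η)
    have h2 := (TwoSidedIdeal.mem_ker _).1 (h1 ((TwoSidedIdeal.rel_iff _ _ _).1 hxy))
    rw [map_sub, sub_eq_zero] at h2
    exact h2)

theorem fromQuot_quotMap (x : Q.FramedPreproj k lam η) :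
    fromQuot Q k lam η (quotMap Q k lam η x) = fromFramed Q k lam η x := rfl

theorem fromQuot_toQuot (x : Q.Preproj lam) : fromQuot Q k lam η (toQuot Q k lam η x) = x := by
  induction x using Preproj.induction with
  | hc t =>
    rw [AlgHom.commutes, ← AlgHom.commutes (quotMap Q k lam η), fromQuot_quotMap, AlgHom.commutes]
  | he j => rw [toQuot_e, fromQuot_quotMap, fromFramed_e_some]
  | ha d => rw [toQuot_arr, fromQuot_quotMap, fromFramed_arr_some]
  | hm x y hx hy => rw [map_mul, map_mul, hx, hy]
  | hs x y hx hy => rw [map_add, map_add, hx, hy]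

/-- The canonical homomorphism `Π^λ(Q) → Π^{λ_α}(Q_∞)/(e_∞)` is an isomorphism. -/
def toQuotEquiv : Q.Preproj lam ≃+* IdemQuot (Q.FramedPreproj k lam η) (Q.eInf k lam η) :=
  RingEquiv.ofRingHom (toQuot Q k lam η).toRingHom (fromQuot Q k lam η)
    (RingHom.ext fun x => by
      obtain ⟨x, rfl⟩ : ∃ y, quotMap Q k lam η y = x := RingCon.mk'_surjective _ x
      exact toQuot_fromFramed Q k lam η x)
    (RingHom.ext fun x => fromQuot_toQuot Q k lam η x)

/-- Inflation of `Π^λ(Q)`-modules to `Π^{λ_α}(Q_∞)`-modules. -/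
def inflate : ModuleCat.{u} (Q.Preproj lam) ⥤ ModuleCat.{u} (Q.FramedPreproj k lam η) :=
  ModuleCat.restrictScalars (fromQuot Q k lam η) ⋙
    ModuleCat.restrictScalars (TwoSidedIdeal.span {Q.eInf k lam η}).ringCon.mk'

/-- Inflation is left adjoint to `Hom_Π(Π/(e_∞), -)`. -/
def inflateAdjunction : inflate.{u} Q k lam η ⊣
    homFromQuot.{u} _ (Q.eInf k lam η) ⋙
      ModuleCat.restrictScalars (Q.toQuot k lam η).toRingHom :=
  -- Restriction along the isomorphism `toQuotEquiv` is an equivalence; it is composed with the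
  -- adjunction between restriction and coextension along `Π → Π/(e_∞)`.
  (ModuleCat.restrictScalarsEquivalenceOfRingEquiv.{_, _, u}
    (toQuotEquiv Q k lam η)).symm.toAdjunction.comp
      (ModuleCat.restrictCoextendScalarsAdj.{u, 0, 0} _)

variable {Q k lam η} {X : ModuleCat.{u} (Q.Preproj lam)}

/-- The identification of the underlying groups of `X` and of its inflation. -/
def inflateVal : (Q.inflate k lam η).obj X ≃+ X := AddEquiv.refl _

theorem inflateVal_smul (r : Q.FramedPreproj k lam η) (x : (Q.inflate k lam η).obj X) :
    inflateVal (r • x) = fromFramed Q k lam η r • inflateVal x := rfl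

theorem inflateVal_smul_complex (t : ℂ) (x : (Q.inflate k lam η).obj X) :
    inflateVal (t • x) = t • inflateVal x := by
  change inflateVal (algebraMap ℂ (Q.FramedPreproj k lam η) t • x) = _
  rw [inflateVal_smul, AlgHom.commutes, algebraMap_smul]

theorem inflateVal_e_none (x : (Q.inflate k lam η).obj X) :
    inflateVal (X := X) (e (Q.framed k) (framedParam lam η) none • x) = 0 := by
  rw [inflateVal_smul, fromFramed_e_none, zero_smul]

theorem inflateVal_e_some (j : I) (x : (Q.inflate k lam η).obj X) :
    inflateVal (X := X) (e (Q.framed k) (framedParam lam η) (some j) • x) = e Q lam j • inflateVal x := by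
  rw [inflateVal_smul, fromFramed_e_some]

theorem inflateVal_arr_none {d : Option A ⊕ Option A} (hd : d = .inl none ∨ d = .inr none)
    (x : (Q.inflate k lam η).obj X) : inflateVal (X := X) (arr (Q.framed k) (framedParam lam η) d • x) = 0 := by
  rw [inflateVal_smul, fromFramed_arr_none _ _ _ _ hd, zero_smul]

theorem inflateVal_arr_some (d : A ⊕ A) (x : (Q.inflate k lam η).obj X) :
    inflateVal (X := X) (arr (Q.framed k) (framedParam lam η) (d.map some some) • x) = arr Q lam d • inflateVal x := by
  rw [inflateVal_smul, fromFramed_arr_some]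

end Inflation

/-! ### Inflation commutes with reflection functors -/

section InflateRefl

open ModuleCat Preproj

variable {Q : FinQuiver I A} {k : I} {lam : I → ℂ} {η : I → ℤ} {i : I} (h : Q.LoopFree i)
  {X : ModuleCat.{u} (Q.Preproj lam)}

theorem framed_tgt_map (Q : FinQuiver I A) (k : I) (d : A ⊕ A) :
    (Q.framed k).tgt (d.map some some) = some (Q.tgt d) := by cases d <;> rfl

theorem framed_src_map (Q : FinQuiver I A) (k : I) (d : A ⊕ A) :
    (Q.framed k).src (d.map some some) = some (Q.src d) := by cases d <;> rfl

theorem swap_map (d : A ⊕ A) : (d.map some some).swap = d.swap.map some some := by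
  cases d <;> rfl

theorem sgn_map (d : A ⊕ A) : sgn (d.map some some) = sgn d := by cases d <;> rfl

theorem map_some_injective :
    Function.Injective (Sum.map (some : A → Option A) (some : A → Option A)) :=
  (Option.some_injective A).sumMap (Option.some_injective A)

/-- The arrows of the double of `Q` that end at `i`, as arrows of the double of `Q_∞`. -/
def intoFramed (Q : FinQuiver I A) (k i : I) (c : Q.Into i) : (Q.framed k).Into (some i) :=
  ⟨c.1.map some some, by rw [framed_tgt_map, c.2]⟩

theorem intoFramed_injective : Function.Injective (intoFramed Q k i) := fun _ _ hcd =>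
  Subtype.ext (map_some_injective (congrArg Subtype.val hcd))

/-- The only arrow ending at `i` that can fail to come from `Q` is `∞ → k`, and it occurs when `i =
k`. -/
theorem into_framed_cases (c : (Q.framed k).Into (some i)) :
    c.1 = .inl none ∨ ∃ c', c = intoFramed Q k i c' := by
  obtain ⟨(_ | a) | (_ | a), hc⟩ := c
  · exact .inl rfl
  · exact .inr ⟨⟨.inl a, Option.some.inj hc⟩, rfl⟩
  · exact absurd hc (by simp [tgt, FinQuiver.framed])
  · exact .inr ⟨⟨.inr a, Option.some.inj hc⟩, rfl⟩

/-- The component at the extra arrow lies in the `e_∞`-part, and `e_∞` acts as zero on an inflation.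
-/
theorem inflate_eq_zero_of_fixed {x : (Q.inflate k lam η).obj X} {c : (Q.framed k).Into (some i)}
    (hc : c.1 = .inl none)
    (hx : e (Q.framed k) (framedParam lam η) ((Q.framed k).src c.1) • x = x) : x = 0 := by
  rw [hc] at hx
  rw [← hx]
  exact inflateVal_e_none x

theorem inflateVal_sum_into (y : (Q.framed k).Into (some i) → (Q.inflate k lam η).obj X)
    (hy : ∀ c, c.1 = .inl none → y c = 0) :
    inflateVal (∑ c, sgn c.1 • (arr (Q.framed k) (framedParam lam η) c.1 • y c)) =
      ∑ c : Q.Into i, sgn c.1 • (arr Q lam c.1 • inflateVal (y (intoFramed Q k i c))) := by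
  rw [map_sum]
  symm
  refine Fintype.sum_of_injective (intoFramed Q k i) intoFramed_injective _ _ ?_ ?_
  · intro c hc
    obtain hc' | ⟨c', rfl⟩ := into_framed_cases c
    · rw [hy c hc', smul_zero, smul_zero, map_zero]
    · exact absurd ⟨c', rfl⟩ hc
  · intro c
    rw [inflateVal_smul_complex]
    change _ = sgn (c.1.map some some) • inflateVal
      (arr (Q.framed k) (framedParam lam η) (c.1.map some some) • _)
    rw [sgn_map, inflateVal_arr_some]

theorem inflateRefl_zero (p : ((Q.framed k).reflFunctor (h.framed k)
      (Q.framedParam_refl k h lam η)).obj ((Q.inflate k lam η).obj X))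
    (c : (Q.framed k).Into (some i)) (hc : c.1 = .inl none) : (reflVal _ _ p).2 c = 0 :=
  inflate_eq_zero_of_fixed hc ((reflVal_mem _ _ p).2.1 c)

theorem inflateRefl_mem (p : ((Q.framed k).reflFunctor (h.framed k)
      (Q.framedParam_refl k h lam η)).obj ((Q.inflate k lam η).obj X)) :
    ((inflateVal (reflVal _ _ p).1, fun c => inflateVal ((reflVal _ _ p).2 (intoFramed Q k i c))) :
      X × (Q.Into i → X)) ∈ reflSpace Q lam i X := by
  obtain ⟨h1, h2, h3⟩ := reflVal_mem _ _ p
  refine ⟨?_, fun c => ?_, ?_⟩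
  · rw [← inflateVal_e_some, h1, map_zero]
  · have := congrArg inflateVal (h2 (intoFramed Q k i c))
    rw [intoFramed, framed_src_map, inflateVal_e_some] at this
    exact this
  · rw [← map_zero (inflateVal (Q := Q) (k := k) (lam := lam) (η := η) (X := X)), ← h3]
    exact (inflateVal_sum_into _ (inflateRefl_zero h p)).symm

theorem inflateRefl_ext {p q : (Q.inflate k (Q.reflParam i lam) (Q.framedRefl k i η)).obj
      ((Q.reflFunctor h rfl).obj X)}
    (hpq : reflVal h rfl (inflateVal p) = reflVal h rfl (inflateVal q)) : p = q :=
  inflateVal.injective (reflVal_injective h rfl hpq)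

variable (k η) in
/-- The natural map from the reflection of an inflation to the inflation of a reflection. -/
def inflateReflFun (X : ModuleCat.{u} (Q.Preproj lam)) :
    ((Q.framed k).reflFunctor (h.framed k) (Q.framedParam_refl k h lam η)).obj
      ((Q.inflate k lam η).obj X) →+
    (Q.inflate k (Q.reflParam i lam) (Q.framedRefl k i η)).obj ((Q.reflFunctor h rfl).obj X) where
  toFun p := inflateVal.symm (reflMk h rfl _ (inflateRefl_mem h p))
  map_zero' := rfl
  map_add' _ _ := rfl

theorem reflVal_inflateReflFun (p) : reflVal h rfl (inflateVal (inflateReflFun k η h X p)) =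
    (inflateVal (reflVal _ _ p).1,
      fun c => inflateVal ((reflVal _ _ p).2 (intoFramed Q k i c))) := rfl

theorem inflateReflFun_e (j : Option I) (p) :
    inflateReflFun k η h X
        (e (Q.framed k) (framedParam (Q.reflParam i lam) (Q.framedRefl k i η)) j • p) =
      e (Q.framed k) (framedParam (Q.reflParam i lam) (Q.framedRefl k i η)) j •
        inflateReflFun k η h X p := by
  apply inflateRefl_ext h
  rw [reflVal_inflateReflFun, reflVal_e]
  cases j with
  | none =>
    rw [inflateVal_e_none, vertexMap_ne _ _ _ _ (by simp), map_zero]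
    exact Prod.ext (inflateVal_e_none _) (funext fun c => map_zero inflateVal)
  | some j =>
    rw [inflateVal_e_some, reflVal_e]
    by_cases hj : j = i
    · subst hj
      rw [vertexMap_self, vertexMap_self, reflVal_inflateReflFun]
      exact Prod.ext (map_zero inflateVal) rfl
    · rw [vertexMap_ne _ _ _ _ (fun hh => hj (Option.some.inj hh)), vertexMap_ne _ _ _ _ hj,
        reflVal_inflateReflFun]
      exact Prod.ext (inflateVal_e_some _ _) (funext fun c => map_zero inflateVal)

/-- Both sides vanish. An arrow at `∞` acts as zero on an inflation. The correction term of `∞ → k`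
sits at the extra component, which is discarded, and its reverse projects to that component, which
is zero. -/
theorem inflateReflFun_arr_none {d : Option A ⊕ Option A} (hd : d = .inl none ∨ d = .inr none) (p) :
    inflateReflFun k η h X
        (arr (Q.framed k) (framedParam (Q.reflParam i lam) (Q.framedRefl k i η)) d • p) =
      arr (Q.framed k) (framedParam (Q.reflParam i lam) (Q.framedRefl k i η)) d •
        inflateReflFun k η h X p := by
  apply inflateRefl_ext h
  rw [reflVal_inflateReflFun, reflVal_arr, inflateVal_arr_none hd, map_zero]
  by_cases ht : (Q.framed k).tgt d = some i
  · rw [dartMap_tgt _ _ _ _ ht]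
    refine Prod.ext (map_zero inflateVal) (funext fun c => ?_)
    have hne : (intoFramed Q k i c).1 ≠ d := by
      rintro rfl
      obtain ⟨c | c, hc⟩ := c <;> simp [intoFramed] at hd
    dsimp only
    rw [if_neg hne, sub_zero, mul_smul, inflateVal_smul, inflateVal_arr_none hd, smul_zero]
    rfl
  · by_cases hs : (Q.framed k).src d = some i
    · rw [dartMap_src _ _ _ _ ht hs]
      refine Prod.ext ?_ (funext fun c => map_zero inflateVal)
      obtain rfl | rfl := hd
      · exact absurd hs (by simp [src, FinQuiver.framed])
      · exact congrArg inflateVal (inflateRefl_zero h p _ rfl)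
    · rw [dartMap_ne _ _ _ _ ht hs]
      exact Prod.ext (inflateVal_arr_none hd _) (funext fun c => map_zero inflateVal)

theorem inflateReflFun_arr_some (d : A ⊕ A) (p) :
    inflateReflFun k η h X (arr (Q.framed k) (framedParam (Q.reflParam i lam) (Q.framedRefl k i η))
      (d.map some some) • p) =
      arr (Q.framed k) (framedParam (Q.reflParam i lam) (Q.framedRefl k i η)) (d.map some some) •
        inflateReflFun k η h X p := by
  apply inflateRefl_ext h
  rw [reflVal_inflateReflFun, reflVal_arr, inflateVal_arr_some, reflVal_arr]
  by_cases ht : Q.tgt d = i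
  · rw [dartMap_tgt _ _ _ _ ht, dartMap_tgt _ _ _ _ (by rw [framed_tgt_map, ht]),
      reflVal_inflateReflFun]
    refine Prod.ext (map_zero inflateVal) (funext fun c => ?_)
    dsimp only
    rw [map_sub, mul_smul (arr _ _ _), mul_smul (arr _ _ _)]
    congr 1
    · change inflateVal (arr (Q.framed k) (framedParam lam η) (c.1.map some some).swap • _) = _
      rw [swap_map, inflateVal_arr_some, inflateVal_arr_some]
    · by_cases hc : c.1 = d
      · rw [if_pos hc, if_pos (show (intoFramed Q k i c).1 = d.map some some from congrArg _ hc),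
          mul_smul, inflateVal_smul_complex, inflateVal_smul_complex, sgn_map,
          framed_src_map, inflateVal_e_some, mul_smul]
        rfl
      · rw [if_neg hc, if_neg (show (intoFramed Q k i c).1 ≠ d.map some some from
          fun hh => hc (map_some_injective hh)), map_zero]
  · have ht' : (Q.framed k).tgt (d.map some some) ≠ some i := by
      rw [framed_tgt_map]
      exact fun hh => ht (Option.some.inj hh)
    by_cases hs : Q.src d = i
    · rw [dartMap_src _ _ _ _ ht hs, dartMap_src _ _ _ _ ht' (by rw [framed_src_map, hs]),
        reflVal_inflateReflFun]
      refine Prod.ext ?_ (funext fun c => map_zero inflateVal)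
      exact congrArg (fun c => inflateVal ((reflVal _ _ p).2 c)) (Subtype.ext (swap_map d))
    · rw [dartMap_ne _ _ _ _ ht hs, dartMap_ne _ _ _ _ ht' (by
        rw [framed_src_map]
        exact fun hh => hs (Option.some.inj hh)), reflVal_inflateReflFun]
      exact Prod.ext (inflateVal_arr_some _ _) (funext fun c => map_zero inflateVal)

variable (k η) in
/-- The natural homomorphism from the reflection of an inflation to the inflation of a
reflection. -/
def inflateReflHom (X : ModuleCat.{u} (Q.Preproj lam)) :
    ((Q.framed k).reflFunctor (h.framed k) (Q.framedParam_refl k h lam η)).obj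
      ((Q.inflate k lam η).obj X) →ₗ[Q.FramedPreproj k (Q.reflParam i lam) (Q.framedRefl k i η)]
    (Q.inflate k (Q.reflParam i lam) (Q.framedRefl k i η)).obj ((Q.reflFunctor h rfl).obj X) :=
  homOfGen (inflateReflFun k η h X)
    (fun t p => by
      apply inflateRefl_ext h
      rw [inflateVal_smul, AlgHom.commutes, reflVal_algebraMap, reflVal_inflateReflFun,
        reflVal_inflateReflFun, reflVal_algebraMap]
      exact Prod.ext (inflateVal_smul_complex _ _) (funext fun c => inflateVal_smul_complex _ _))
    (inflateReflFun_e h)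
    (fun d p => by
      rcases d with (_ | a) | (_ | a)
      · exact inflateReflFun_arr_none h (.inl rfl) p
      · exact inflateReflFun_arr_some h (.inl a) p
      · exact inflateReflFun_arr_none h (.inr rfl) p
      · exact inflateReflFun_arr_some h (.inr a) p)

/-- Discarding the component at `∞ → k` loses nothing, since it is already zero. -/
theorem inflateReflHom_injective : Function.Injective (inflateReflHom k η h X) := by
  rw [injective_iff_map_eq_zero]
  intro p hp
  have hp' := congrArg (fun q => reflVal h rfl (inflateVal q)) hp
  change (inflateVal (reflVal _ _ p).1,
      fun c => inflateVal ((reflVal _ _ p).2 (intoFramed Q k i c))) = (0, fun _ => 0) at hp'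
  apply reflVal_injective
  have h1 := congrArg Prod.fst hp'
  have h2 := congrArg Prod.snd hp'
  refine Prod.ext h1 (funext fun c => ?_)
  obtain hc | ⟨c, rfl⟩ := into_framed_cases c
  · exact inflateRefl_zero h p c hc
  · exact congrFun h2 c

theorem inflateReflHom_surjective : Function.Surjective (inflateReflHom k η h X) := by
  intro q
  obtain ⟨h1, h2, h3⟩ := reflVal_mem h rfl (inflateVal q)
  -- The family is extended by zero to the possible extra arrow `∞ → k`.
  let y : (Q.framed k).Into (some i) → (Q.inflate k lam η).obj X :=
    Function.extend (intoFramed Q k i)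
      (fun c => inflateVal.symm ((reflVal h rfl (inflateVal q)).2 c)) 0
  have hy : ∀ c, y (intoFramed Q k i c) =
      inflateVal.symm ((reflVal h rfl (inflateVal q)).2 c) := fun c =>
    intoFramed_injective.extend_apply _ _ c
  have hy0 : ∀ c, c.1 = .inl none → y c = 0 := fun c hc =>
    Function.extend_apply' _ _ c (by
      rintro ⟨⟨c' | c', _⟩, rfl⟩ <;> simp [intoFramed] at hc)
  refine ⟨reflMk _ _ (inflateVal.symm (reflVal h rfl (inflateVal q)).1, y) ⟨?_, fun c => ?_, ?_⟩, ?_⟩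
  · apply inflateVal.injective
    rw [inflateVal_e_some, AddEquiv.apply_symm_apply, h1, map_zero]
  · obtain hc | ⟨c, rfl⟩ := into_framed_cases c
    · dsimp only
      rw [hy0 c hc, smul_zero]
    · apply inflateVal.injective
      dsimp only
      rw [hy, intoFramed, framed_src_map, inflateVal_e_some, AddEquiv.apply_symm_apply, h2]
  · apply inflateVal.injective
    rw [inflateVal_sum_into _ hy0, map_zero, ← h3]
    simp only [hy, AddEquiv.apply_symm_apply]
  · apply inflateRefl_ext h
    refine Prod.ext rfl (funext fun c => ?_)
    exact congrArg inflateVal (hy c)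

variable (Q k lam η) in
/-- Inflation commutes with reflection functors. -/
def inflateReflIso : Q.inflate k lam η ⋙ Q.framedReflFunctor k h lam η ≅
    (Q.reflFunctor h rfl ⋙ Q.inflate k (Q.reflParam i lam) (Q.framedRefl k i η) :
      ModuleCat.{u} (Q.Preproj lam) ⥤ _) :=
  NatIso.ofComponents
    (fun X => (LinearEquiv.ofBijective (inflateReflHom k η h X)
      ⟨inflateReflHom_injective h, inflateReflHom_surjective h⟩).toModuleIso)
    (fun _ => rfl)

end InflateRefl

/-! ### The functor `F` commutes with reflection functors -/

/-- The two sides are right adjoint to `L' ⋙ E'.inverse` and `E.inverse ⋙ L`, and these are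
isomorphic by conjugating `f` with the equivalences. -/
theorem nonempty_rightAdjoint_iso {C₁ C₂ D₁ D₂ : Type*} [Category C₁] [Category C₂] [Category D₁]
    [Category D₂] {L : C₁ ⥤ D₁} {G : D₁ ⥤ C₁} {L' : C₂ ⥤ D₂} {G' : D₂ ⥤ C₂} (a : L ⊣ G)
    (a' : L' ⊣ G') (E : C₁ ≌ C₂) (E' : D₁ ≌ D₂) (f : L ⋙ E'.functor ≅ E.functor ⋙ L') :
    Nonempty (E'.functor ⋙ G' ≅ G ⋙ E.functor) := by
  have f' : L' ⋙ E'.inverse ≅ E.inverse ⋙ L :=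
    (Functor.leftUnitor _).symm ≪≫ Functor.isoWhiskerRight E.counitIso.symm (L' ⋙ E'.inverse) ≪≫
      Functor.isoWhiskerLeft E.inverse (Functor.isoWhiskerRight f.symm E'.inverse ≪≫
        Functor.isoWhiskerLeft L E'.unitIso.symm ≪≫ Functor.rightUnitor L)
  exact ⟨((a'.comp E'.symm.toAdjunction).ofNatIsoLeft f').rightAdjointUniq
    (E.symm.toAdjunction.comp a)⟩

/-- The isomorphism is pasted from two: `f` for the corner functor at `∞ ≠ i`, and `g` for the right
adjoint of inflation. -/
theorem nonempty_bceFunctor_iso (Q : FinQuiver I A) (k : I) {i : I} (h : Q.LoopFree i)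
    (lam : I → ℂ) (η : I → ℤ) (hi : lam i ≠ 0) :
    Nonempty (Q.framedReflFunctor k h lam η ⋙
        Q.bceFunctor k (Q.reflParam i lam) (Q.framedRefl k i η) ≅
      (Q.bceFunctor k lam η ⋙ Q.reflFunctor h rfl :
        ModuleCat.{u} (Q.FramedPreproj k lam η) ⥤ ModuleCat.{u} (Q.Preproj (Q.reflParam i lam)))) := by
  obtain ⟨f⟩ := nonempty_cornerTensor_reflFunctor_iso.{u} (h.framed k)
    (Q.framedParam_refl k h lam η) (j := none) (by simp) hi
  obtain ⟨g⟩ := nonempty_rightAdjoint_iso (inflateAdjunction.{u} Q k lam η)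
    (inflateAdjunction.{u} Q k (Q.reflParam i lam) (Q.framedRefl k i η))
    (reflEquivalence h rfl hi)
    (reflEquivalence (h.framed k) (Q.framedParam_refl k h lam η) hi) (inflateReflIso Q k lam η h)
  have f' := Functor.isoWhiskerRight f (homFromQuot.{u} _ (Q.eInf k _ _) ⋙
    ModuleCat.restrictScalars (Q.toQuot k (Q.reflParam i lam) (Q.framedRefl k i η)).toRingHom)
  exact ⟨f' ≪≫ Functor.isoWhiskerLeft (cornerTensor.{u} _ (Q.eInf k lam η)) g⟩

/-! ### Words in the reflections -/

/-- Duality of `r_i` and `s_i`; through it regularity and the formula for `w(λ_α)` are transported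
along words. -/
theorem pairing_reflParam_eq (Q : FinQuiver I A) (i : I) (lam : I → ℂ) (β : I → ℤ) :
    pairing (Q.reflParam i lam) β = pairing lam (Q.refl i β) := by
  rw [pairing_reflParam, refl]
  simp only [pairing, Pi.sub_apply, Pi.smul_apply, Int.cast_sub, mul_sub, Finset.sum_sub_distrib]
  congr 1
  rw [Finset.sum_eq_single i]
  · simp [coord, mul_comm]
  · intro j _ hj
    simp [coord, hj]
  · simp

theorem IsRegular.apply_ne_zero {Q : FinQuiver I A} {lam : I → ℂ} (hlam : Q.IsRegular lam) {i : I}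
    (h : Q.LoopFree i) : lam i ≠ 0 := by
  have := hlam (coord i) ⟨1, one_mem _, i, h, rfl⟩
  simpa [pairing, coord, Pi.single_apply] using this

/-- Pairing `r_i(λ)` with a real root is pairing `λ` with its image under `s_i`, which is again a
real root. -/
theorem IsRegular.reflParam {Q : FinQuiver I A} {lam : I → ℂ} (hlam : Q.IsRegular lam) {i : I}
    (h : Q.LoopFree i) : Q.IsRegular (Q.reflParam i lam) := by
  rintro _ ⟨w, hw, j, hj, rfl⟩
  rw [pairing_reflParam_eq]
  exact hlam _ ⟨Q.reflEquiv h * w, mul_mem (Subgroup.subset_closure ⟨i, h, rfl⟩) hw, j, hj, rfl⟩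

theorem IsRegular.wordParam {Q : FinQuiver I A} {lam : I → ℂ} (hlam : Q.IsRegular lam)
    (l : List Q.LF) : Q.IsRegular (Q.wordParam l lam) := by
  induction l with
  | nil => exact hlam
  | cons i l ih => exact ih.reflParam i.2

theorem framedDim_framedRefl (Q : FinQuiver I A) (k i : I) (η : I → ℤ) :
    framedDim (Q.framedRefl k i η) = (Q.framed k).refl (some i) (framedDim η) := by
  funext j
  cases j with
  | none =>
    rw [refl_apply_ne (Q.framed k) (Option.some_ne_none i).symm]
    simp only [framedDim, Option.elim_none]
  | some j => simp only [framedDim, framedRefl, Option.elim_some]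

theorem wordElt_cons (Q : FinQuiver I A) (k : I) (i : Q.LF) (l : List Q.LF) :
    Q.wordElt k (i :: l) = (Q.framed k).reflEquiv (i.2.framed k) * Q.wordElt k l :=
  List.prod_cons

theorem framedDim_wordDim (Q : FinQuiver I A) (k : I) (l : List Q.LF) (η : I → ℤ) :
    framedDim (Q.wordDim k l η) = Q.wordElt k l (framedDim η) := by
  induction l with
  | nil => rfl
  | cons i l ih =>
    rw [wordDim, framedDim_framedRefl, ih, wordElt_cons]
    rfl

/-- Each letter contributes the duality of `r_i` and `s_i`. The closing `rfl` uses that `reflEquiv`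
has `s_i` as its own inverse function by definition. -/
theorem pairing_wordParam (Q : FinQuiver I A) (k : I) (l : List Q.LF) (lam : I → ℂ) (η : I → ℤ)
    (β : Option I → ℤ) :
    pairing (framedParam (Q.wordParam l lam) (Q.wordDim k l η)) β =
      pairing (framedParam lam η) ((Q.wordElt k l)⁻¹ β) := by
  induction l generalizing β with
  | nil => rfl
  | cons i l ih =>
    rw [wordDim, wordParam, framedParam_refl Q k i.2, pairing_reflParam_eq, ih, wordElt_cons,
      mul_inv_rev]
    rfl

theorem exists_wordElt_eq (Q : FinQuiver I A) (k : I) {w : (Option I → ℤ) ≃ₗ[ℤ] (Option I → ℤ)}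
    (hw : w ∈ Q.wInf k) : ∃ l : List Q.LF, Q.wordElt k l = w := by
  induction hw using Subgroup.closure_induction with
  | mem _ h =>
    obtain ⟨i, rfl⟩ := h
    exact ⟨[i], List.prod_singleton⟩
  | one => exact ⟨[], rfl⟩
  | mul _ _ _ _ h1 h2 =>
    obtain ⟨l, rfl⟩ := h1
    obtain ⟨l', rfl⟩ := h2
    exact ⟨l ++ l', by rw [wordElt, List.map_append, List.prod_append]; rfl⟩
  | inv _ _ h =>
    obtain ⟨l, rfl⟩ := h
    -- Simple reflections are involutions, so the reversed word represents the inverse.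
    refine ⟨l.reverse, ?_⟩
    rw [wordElt, wordElt, List.prod_inv_reverse, List.map_map, List.map_reverse]
    rfl

theorem bijOn_indecProj_wordFunctor (Q : FinQuiver I A) {lam : I → ℂ} (hlam : Q.IsRegular lam)
    (l : List Q.LF) : Set.BijOn (onClasses (Q.wordFunctor l lam))
      (indecProj.{u} (Q.Preproj lam)) (indecProj.{u} (Q.Preproj (Q.wordParam l lam))) := by
  induction l with
  | nil => exact bijOn_indecProj CategoryTheory.Equivalence.refl
  | cons i l ih =>
    have := (bijOn_indecProj (reflEquivalence.{u} i.2 rfl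
      ((hlam.wordParam l).apply_ne_zero i.2))).comp ih
    exact this.congr fun x _ => (onClasses_comp _ _ x).symm

/-- Regularity over `Q` suffices: only vertices `i ≠ ∞` occur, and there the coordinate of `λ_α` is
`λ_i`. -/
theorem bijOn_quiverVariety_framedWordFunctor (Q : FinQuiver I A) (k : I) {lam : I → ℂ}
    (hlam : Q.IsRegular lam) (l : List Q.LF) (η : I → ℤ) :
    Set.BijOn (onClasses (Q.framedWordFunctor k l lam η))
      ((Q.framed k).quiverVariety.{u} (framedParam lam η) (framedDim η))
      ((Q.framed k).quiverVariety.{u} (framedParam (Q.wordParam l lam) (Q.wordDim k l η))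
        (framedDim (Q.wordDim k l η))) := by
  induction l with
  | nil => exact (Set.bijOn_id _).congr fun x _ => (onClasses_id x).symm
  | cons i l ih =>
    have := (bijOn_quiverVariety.{u} (i.2.framed k) (Q.framedParam_refl k i.2 (Q.wordParam l lam)
      (Q.wordDim k l η)) ((hlam.wordParam l).apply_ne_zero i.2)
        (framedDim (Q.wordDim k l η))).comp ih
    rw [← framedDim_framedRefl] at this
    exact this.congr fun x _ => (onClasses_comp _ _ x).symm

theorem onClasses_bceFunctor_framedWordFunctor (Q : FinQuiver I A) (k : I) {lam : I → ℂ}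
    (hlam : Q.IsRegular lam) (l : List Q.LF) (η : I → ℤ)
    (x : IsoClass.{u} (Q.FramedPreproj k lam η)) :
    onClasses (Q.bceFunctor k (Q.wordParam l lam) (Q.wordDim k l η))
        (onClasses (Q.framedWordFunctor k l lam η) x) =
      onClasses (Q.wordFunctor l lam) (onClasses (Q.bceFunctor k lam η) x) := by
  induction l with
  | nil =>
    exact (congrArg (onClasses (Q.bceFunctor k lam η)) (onClasses_id x)).trans
      (onClasses_id _).symm
  | cons i l ih =>
    obtain ⟨f⟩ := nonempty_bceFunctor_iso.{u} Q k i.2 (Q.wordParam l lam) (Q.wordDim k l η)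
      ((hlam.wordParam l).apply_ne_zero i.2)
    have h1 := congrFun (onClasses_congr f) (onClasses (Q.framedWordFunctor k l lam η) x)
    rw [onClasses_comp, onClasses_comp, ih] at h1
    refine Eq.trans ?_ (h1.trans (onClasses_comp _ _ _).symm)
    exact congrArg _ (onClasses_comp _ _ x)

end FinQuiver

end

/-! ### Equivariance of `F` under reflections and under `W_∞` -/

open FinQuiver in
theorem mainTheorem7 {I A : Type} [Fintype I] [DecidableEq I] [Fintype A] [DecidableEq A]
    (Q : FinQuiver I A) (k : I) :
    -- `F` commutes with the reflection functors at the vertices `i ≠ ∞`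
    (∀ (i : I) (hi : Q.LoopFree i) (lam : I → ℂ) (η : I → ℤ), lam i ≠ 0 →
      Nonempty
        (Q.framedReflFunctor k hi lam η ⋙
            Q.bceFunctor k (Q.reflParam i lam) (Q.framedRefl k i η) ≅
          (Q.bceFunctor k lam η ⋙ Q.reflFunctor hi rfl :
            ModuleCat.{u} (Q.FramedPreproj k lam η) ⥤
              ModuleCat.{u} (Q.Preproj (Q.reflParam i lam))))) ∧
    -- the induced map on isomorphism classes is `W_∞`-equivariant
    (∀ lam : I → ℂ, Q.IsRegular lam → ∀ w ∈ Q.wInf k,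
      (∃ l : List Q.LF, Q.wordElt k l = w) ∧
      ∀ l : List Q.LF, Q.wordElt k l = w →
        Set.BijOn (onClasses (Q.wordFunctor l lam))
          (indecProj.{u} (Q.Preproj lam)) (indecProj.{u} (Q.Preproj (Q.wordParam l lam))) ∧
        ∀ η : I → ℤ,
          framedDim (Q.wordDim k l η) = w (framedDim η) ∧
          (∀ β : Option I → ℤ,
            pairing (framedParam (Q.wordParam l lam) (Q.wordDim k l η)) β =
              pairing (framedParam lam η) (w⁻¹ β)) ∧
          Set.BijOn (onClasses (Q.framedWordFunctor k l lam η))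
            ((Q.framed k).quiverVariety (framedParam lam η) (framedDim η))
            ((Q.framed k).quiverVariety
              (framedParam (Q.wordParam l lam) (Q.wordDim k l η)) (w (framedDim η))) ∧
          ∀ x : IsoClass.{u} (Q.FramedPreproj k lam η),
            onClasses (Q.bceFunctor k (Q.wordParam l lam) (Q.wordDim k l η))
                (onClasses (Q.framedWordFunctor k l lam η) x) =
              onClasses (Q.wordFunctor l lam) (onClasses (Q.bceFunctor k lam η) x)) := by
  refine ⟨fun i hi lam η h => nonempty_bceFunctor_iso Q k hi lam η h,
    fun lam hlam w hw => ⟨exists_wordElt_eq Q k hw, ?_⟩⟩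
  rintro l rfl
  refine ⟨bijOn_indecProj_wordFunctor Q hlam l, fun η => ⟨framedDim_wordDim Q k l η,
    pairing_wordParam Q k l lam η, ?_, onClasses_bceFunctor_framedWordFunctor Q k hlam l η⟩⟩
  rw [← framedDim_wordDim]
  exact bijOn_quiverVariety_framedWordFunctor Q k hlam l η
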